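/- Let \(\mathbb D\) be the open unit disc, \(H^\infty\) the algebra of bounded analytic functions on \(\mathbb D\) with the supremum norm, and \(\mathcal M\) its maximal ideal space, that is, the set of nonzero multiplicative linear functionals on \(H^\infty\) with the weak star topology. A point \(z\in\mathbb D\) is identified with the functional \(f\mapsto f(z)\); by the corona theorem \(\mathbb D\) is dense in \(\mathcal M\). Let \(\pi:\mathcal M\to\overline{\mathbb D}\) be the projection \(\pi(\varphi)=\varphi(\mathrm{id})\), where \(\mathrm{id}(z)=z\). For \(w,z\in\mathbb D\) put \(L_w(z)=\dfrac{z+w}{1+\overline w z}\), and for \(m,x,y\in\mathcal M\) and \(z\in\mathbb D\) define \[ L_m(z)=\lim_{w\to m}L_w(z)\in\mathcal M,\qquad \lambda(x,y)=\lim_{w\to y}\frac{1+\overline{\pi(x)}\,w}{1+\pi(x)\,\overline w}\in\partial\mathbb D , \] where \(w\) runs through any net in \(\mathbb D\) that converges to \(m\), respectively to \(y\), in \(\mathcal M\). These limits exist and do not depend on the net, and each \(L_m:\mathbb D\to\mathcal M\) is analytic, meaning that \(f\circ L_m\in H^\infty\) for every \(f\in H^\infty\), where \(f\circ L_m\) denotes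 the function \(z\mapsto L_m(z)(f)\). Hence \(L_m\) extends to a map \(L_m:\mathcal M\to\mathcal M\) by \(L_m(\varphi)(f)=\varphi(f\circ L_m)\). For all \(m,y\in\mathcal M\) and all \(z\in\mathbb D\), \[ L_m\bigl(L_y(\lambda(m,y)\,z)\bigr)=L_{L_m(y)}(z). \] -/

import Mathlib

open Filter Topology
open scoped ComplexConjugate BoundedContinuousFunction Complex.UnitDisc

namespace Hoffman

/-- The algebra `H^∞` of bounded analytic functions on the open unit disc, with pointwise
operations and the supremum norm (inherited from the bounded continuous functions). -/
def Hinf : Subalgebra ℂ (𝔻 →ᵇ ℂ) where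
  carrier := {f | ∃ g : ℂ → ℂ, DifferentiableOn ℂ g (Metric.ball 0 1) ∧ ∀ z : 𝔻, g z = f z}
  mul_mem' := by
    rintro a b ⟨g, hg, hga⟩ ⟨k, hk, hkb⟩
    exact ⟨fun z => g z * k z, hg.mul hk, fun z => by simp [hga, hkb]⟩
  add_mem' := by
    rintro a b ⟨g, hg, hga⟩ ⟨k, hk, hkb⟩
    exact ⟨fun z => g z + k z, hg.add hk, fun z => by simp [hga, hkb]⟩
  algebraMap_mem' := fun c => ⟨fun _ => c, differentiableOn_const c, fun _ => rfl⟩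

/-- The maximal ideal space of `H^∞`: the nonzero multiplicative linear functionals on `H^∞`, with
the weak star topology. -/
abbrev MaxIdeal : Type := WeakDual.characterSpace ℂ Hinf

/-- Characters of `H^∞` are contractive. -/
theorem norm_apply_le (φ : MaxIdeal) (f : Hinf) : ‖φ f‖ ≤ ‖f‖ := by
  by_contra! h
  have hpos : 0 < ‖φ f‖ := (norm_nonneg f).trans_lt h
  have hlim : Tendsto (fun n : ℕ => ‖WeakDual.CharacterSpace.toCLM φ‖ * (‖f‖ / ‖φ f‖) ^ n) atTop
      (𝓝 (‖WeakDual.CharacterSpace.toCLM φ‖ * 0)) :=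
    (tendsto_pow_atTop_nhds_zero_of_lt_one (by positivity) ((div_lt_one hpos).2 h)).const_mul _
  rw [mul_zero] at hlim
  obtain ⟨n, hn, hn1⟩ := ((hlim.eventually (gt_mem_nhds one_pos)).and (eventually_ge_atTop 1)).exists
  have h1 : ‖φ f‖ ^ n ≤ ‖WeakDual.CharacterSpace.toCLM φ‖ * ‖f‖ ^ n := by
    have h2 := (WeakDual.CharacterSpace.toCLM φ).le_opNorm (f ^ n)
    rw [WeakDual.CharacterSpace.coe_toCLM, map_pow, norm_pow] at h2
    exact h2.trans (mul_le_mul_of_nonneg_left (norm_pow_le' f hn1) (norm_nonneg _))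
  rw [div_pow, ← mul_div_assoc, div_lt_one (by positivity)] at hn
  exact absurd h1 (not_le.2 hn)

/-- The embedding of the disc into the maximal ideal space: a point `z` of the disc is the
character `f ↦ f z`. -/
noncomputable def point (z : 𝔻) : MaxIdeal :=
  ⟨((BoundedContinuousFunction.evalCLM ℂ z).comp Hinf.toSubmodule.subtypeL : Hinf →L[ℂ] ℂ),
    fun h => one_ne_zero (α := ℂ) (DFunLike.congr_fun h (1 : Hinf)), fun _ _ => rfl⟩

theorem point_apply (z : 𝔻) (f : Hinf) : point z f = (f : 𝔻 →ᵇ ℂ) z := rfl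

noncomputable instance : Nonempty MaxIdeal := ⟨point 0⟩

/-- The identity function `z ↦ z` as an element of `H^∞`. -/
noncomputable def idHinf : Hinf :=
  ⟨BoundedContinuousFunction.ofNormedAddCommGroup (fun z : 𝔻 => (z : ℂ))
      Complex.UnitDisc.continuous_coe 1 fun z => z.norm_lt_one.le,
    fun z => z, differentiableOn_id, fun _ => rfl⟩

theorem norm_idHinf_le : ‖idHinf‖ ≤ 1 :=
  BoundedContinuousFunction.norm_ofNormedAddCommGroup_le _ zero_le_one
    fun z => z.norm_lt_one.le

/-- The natural projection of the maximal ideal space onto the closed unit disc: the value of a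
character at the identity function. -/
noncomputable def proj (φ : MaxIdeal) : 𝕔𝔻 :=
  Complex.UnitClosedDisc.mk (φ idHinf) ((norm_apply_le φ idHinf).trans norm_idHinf_le)

theorem one_add_mul_ne_zero (a b : ℂ) (ha : ‖a‖ ≤ 1) (hb : ‖b‖ < 1) : 1 + a * b ≠ 0 := by
  intro h
  have h1 : ‖a * b‖ = 1 := by
    rw [← neg_eq_iff_add_eq_zero.2 h, norm_neg, norm_one]
  rw [norm_mul] at h1
  nlinarith [norm_nonneg a, norm_nonneg b]

/-- The disc automorphism `L_w z = (z + w) / (1 + conj w * z)`. -/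
noncomputable def mobius (w z : 𝔻) : 𝔻 :=
  Complex.UnitDisc.mk (((z : ℂ) + w) / (1 + conj (w : ℂ) * z)) (by
    have hw := w.normSq_lt_one
    have hz := z.normSq_lt_one
    have hne : 1 + conj (w : ℂ) * z ≠ 0 :=
      one_add_mul_ne_zero _ _ (by rw [Complex.norm_conj]; exact w.norm_lt_one.le) z.norm_lt_one
    rw [norm_div, div_lt_one (norm_pos_iff.2 hne), ← sq_lt_sq₀ (norm_nonneg _) (norm_nonneg _),
      Complex.sq_norm, Complex.sq_norm]
    simp only [Complex.normSq_apply, Complex.add_re, Complex.add_im, Complex.mul_re,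
      Complex.mul_im, Complex.conj_re, Complex.conj_im, Complex.one_re, Complex.one_im] at *
    nlinarith [mul_pos (sub_pos.2 hw) (sub_pos.2 hz)])

/-- The trace on the disc of the neighbourhoods of a point `m` of the maximal ideal space. Limits
along this filter are limits along arbitrary nets in the disc that converge to `m`. -/
noncomputable def toward (m : MaxIdeal) : Filter 𝔻 := comap point (𝓝 m)

open Classical in
/-- The Hoffman map `L_m z = lim L_{w} z` as `w → m` through the disc. (Every point of the maximal
ideal space is a limit of points of the disc; a point that were not would get the constant map.) -/
noncomputable def hoffman (m : MaxIdeal) (z : 𝔻) : MaxIdeal :=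
  if (toward m).NeBot then limUnder (toward m) (fun w => point (mobius w z)) else m

/-- A map `τ` from the disc to the maximal ideal space is analytic if `f ∘ τ` belongs to `H^∞`
for every `f` in `H^∞`. -/
def IsAnalyticMap (τ : 𝔻 → MaxIdeal) : Prop :=
  ∀ f : Hinf, ∃ g : Hinf, ∀ z : 𝔻, (g : 𝔻 →ᵇ ℂ) z = τ z f

/-- The function `f ∘ τ`, as an element of `H^∞`. -/
noncomputable def pullback (τ : 𝔻 → MaxIdeal) (hτ : IsAnalyticMap τ) (f : Hinf) : Hinf :=
  (hτ f).choose

theorem pullback_apply (τ : 𝔻 → MaxIdeal) (hτ : IsAnalyticMap τ) (f : Hinf) (z : 𝔻) :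
    (pullback τ hτ f : 𝔻 →ᵇ ℂ) z = τ z f :=
  (hτ f).choose_spec z

theorem hinf_ext {f g : Hinf} (h : ∀ z : 𝔻, (f : 𝔻 →ᵇ ℂ) z = (g : 𝔻 →ᵇ ℂ) z) : f = g :=
  Subtype.ext (DFunLike.ext _ _ h)

theorem norm_pullback_le (τ : 𝔻 → MaxIdeal) (hτ : IsAnalyticMap τ) (f : Hinf) :
    ‖pullback τ hτ f‖ ≤ ‖f‖ :=
  (BoundedContinuousFunction.norm_le (norm_nonneg f)).2 fun z => by
    change ‖(pullback τ hτ f : 𝔻 →ᵇ ℂ) z‖ ≤ ‖f‖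
    rw [pullback_apply]
    exact norm_apply_le _ _

/-- The extension `τ* : M → M` of an analytic map `τ` from the disc to the maximal ideal space `M`,
given by `(τ* φ) f = φ (f ∘ τ)`. -/
noncomputable def extend (τ : 𝔻 → MaxIdeal) (hτ : IsAnalyticMap τ) (φ : MaxIdeal) : MaxIdeal :=
  ⟨(LinearMap.mkContinuous
      { toFun := fun f => φ (pullback τ hτ f)
        map_add' := fun f g => by
          rw [← map_add]
          exact congrArg φ (hinf_ext fun z => by simp [pullback_apply])
        map_smul' := fun c f => by
          rw [RingHom.id_apply, ← map_smul]
          exact congrArg φ (hinf_ext fun z => by simp [pullback_apply]) }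
      1 fun f => by
        rw [one_mul]
        exact (norm_apply_le _ _).trans (norm_pullback_le τ hτ f) : Hinf →L[ℂ] ℂ),
    fun h => one_ne_zero (α := ℂ) (by
      have h1 : φ (pullback τ hτ 1) = 0 := DFunLike.congr_fun h (1 : Hinf)
      have h2 : pullback τ hτ 1 = 1 := hinf_ext fun z => by simp [pullback_apply]
      rwa [h2, map_one] at h1),
    fun f g => by
      change φ (pullback τ hτ (f * g)) = φ (pullback τ hτ f) * φ (pullback τ hτ g)
      rw [← map_mul]
      exact congrArg φ (hinf_ext fun z => by simp [pullback_apply])⟩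

theorem extend_apply (τ : 𝔻 → MaxIdeal) (hτ : IsAnalyticMap τ) (φ : MaxIdeal) (f : Hinf) :
    extend τ hτ φ f = φ (pullback τ hτ f) := rfl

/-- The unimodular quotient `(1 + conj a * w) / (1 + a * conj w)`, for `a` in the closed disc and
`w` in the open disc. -/
noncomputable def unimodularQuotient (a : 𝕔𝔻) (w : 𝔻) : Circle :=
  ⟨(1 + conj (a : ℂ) * w) / (1 + (a : ℂ) * conj (w : ℂ)), by
    have hne : 1 + (a : ℂ) * conj (w : ℂ) ≠ 0 :=
      one_add_mul_ne_zero _ _ a.norm_le_one (by rw [Complex.norm_conj]; exact w.norm_lt_one)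
    have hc : 1 + conj (a : ℂ) * w = conj (1 + (a : ℂ) * conj (w : ℂ)) := by simp
    refine mem_sphere_zero_iff_norm.2 ?_
    rw [hc, norm_div, Complex.norm_conj, div_self (norm_ne_zero_iff.2 hne)]⟩

/-- The function `λ(x, y) = lim (1 + conj (π x) * w) / (1 + π x * conj w)` as `w → y` through the
disc, with values in the unit circle. -/
noncomputable def budde (x y : MaxIdeal) : Circle :=
  limUnder (toward y) (unimodularQuotient (proj x))

end Hoffman

open Hoffman

/-!
The formula `L_m (L_y (λ(m, y) z)) = L_{L_m y} z` is the limit of the identity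
`L_w (L_v (λ z)) = L_{L_w v} z` of disc automorphisms, first as `w → m` and then as `v → y`
(`mobius_mobius`, `hoffman_mobius`, `extend_hoffman_hoffman`). The substance is that the limits
exist, and that the formula survives at characters `y` outside the closure of the disc. By the
corona theorem there are no such characters; the argument below does not use that theorem.

*Existence of `L_m`.* Suppose that along some ultrafilter tending to `m` some `f ∘ L_w` has a
nonconstant limit. By Hurwitz's theorem some `f - α` has, at bounded pseudohyperbolic distance
from `w`, a zero `ζ` with `(1 - |ζ| ^ 2) |f' ζ|` bounded below. The Schwarz lemma shows
at once that such zeros satisfy Carleson's condition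
(`isInterpolating_simpleZeros`). An ultrafilter on them lives on a sparse subset, and a sparse set
may be moved by a fixed pseudohyperbolic distance, so `m` is a limit of points of an interpolating
set `Z` (`exists_isInterpolating`). Carleson's interpolation theorem, proved through P. Jones's
explicit formula, gives `g` with `g a = f (L_a z)` for `a ∈ Z`. The Blaschke product of `Z`
vanishes at `m` and is bounded below away from `Z`, so every `w` near `m` is close to `Z`, and
`f (L_w z)` is close to `g w`, which tends to `m g`
(`IsInterpolating.exists_eventually_norm_sub_le`). If there is no such ultrafilter,
`f (L_w z) → m f`.

*Existence of `λ`.* The quotient is `exp (2 i arg u)` with `arg u = -log |exp (i log u)|`, where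
`exp (i log u)` is an invertible bounded analytic function (`tendsto_budde`).

*Characters `y` outside the closure of the disc.* If `m` is in the closure, the formula says
that `L_x` is constant for `x = L_m y`. Otherwise `x` would be a limit of points of an
interpolating set with Blaschke product `B`, and `y (B ∘ L_m) = 0`. A corona problem whose data
include such a `B ∘ L_m` is solved by interpolation on its zeros, which forces `y` into the closure
(`neBot_of_extend_hoffman`).
-/

namespace Hoffman

/-! ### The pseudohyperbolic distance -/

theorem coe_mobius (w z : 𝔻) :
    (mobius w z : ℂ) = ((z : ℂ) + w) / (1 + conj (w : ℂ) * z) := rfl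

theorem one_add_conj_mul_ne_zero (w z : 𝔻) : 1 + conj (w : ℂ) * z ≠ 0 :=
  one_add_mul_ne_zero _ _ (by rw [Complex.norm_conj]; exact w.norm_lt_one.le) z.norm_lt_one

theorem one_sub_conj_mul_ne_zero (w z : 𝔻) : 1 - conj (w : ℂ) * z ≠ 0 := by
  simpa [sub_eq_add_neg] using one_add_conj_mul_ne_zero (-w) z

theorem one_add_mul_conj_ne_zero (w z : 𝔻) : 1 + (w : ℂ) * conj (z : ℂ) ≠ 0 := by
  rw [mul_comm]; exact one_add_conj_mul_ne_zero z w

theorem one_sub_sq_pos (z : 𝔻) : 0 < 1 - ‖(z : ℂ)‖ ^ 2 := sub_pos.2 z.sq_norm_lt_one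

/-- The pseudohyperbolic distance `|(z - w) / (1 - conj w * z)|`. -/
noncomputable def rho (z w : 𝔻) : ℝ := ‖(mobius (-w) z : ℂ)‖

theorem rho_eq (z w : 𝔻) : rho z w = ‖((z : ℂ) - w) / (1 - conj (w : ℂ) * z)‖ := by
  simp [rho, coe_mobius, sub_eq_add_neg]

theorem rho_nonneg (z w : 𝔻) : 0 ≤ rho z w := norm_nonneg _

theorem rho_lt_one (z w : 𝔻) : rho z w < 1 := (mobius (-w) z).norm_lt_one

theorem rho_self (z : 𝔻) : rho z z = 0 := by simp [rho_eq]

theorem rho_zero (z : 𝔻) : rho z 0 = ‖(z : ℂ)‖ := by simp [rho_eq]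

theorem rho_comm (z w : 𝔻) : rho z w = rho w z := by
  rw [rho_eq, rho_eq, norm_div, norm_div, norm_sub_rev, ← Complex.norm_conj (1 - _)]
  simp [mul_comm]

theorem rho_eq_zero {z w : 𝔻} : rho z w = 0 ↔ z = w := by
  rw [rho_eq, norm_eq_zero, div_eq_zero_iff, or_iff_left (one_sub_conj_mul_ne_zero w z),
    sub_eq_zero, Complex.UnitDisc.coe_inj]

theorem norm_one_sub_conj_mul_sq (w z : ℂ) :
    ‖1 - conj w * z‖ ^ 2 = ‖z - w‖ ^ 2 + (1 - ‖z‖ ^ 2) * (1 - ‖w‖ ^ 2) := by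
  simp only [Complex.sq_norm, Complex.normSq_apply, Complex.sub_re, Complex.sub_im,
    Complex.mul_re, Complex.mul_im, Complex.conj_re, Complex.conj_im, Complex.one_re,
    Complex.one_im]
  ring

theorem one_sub_rho_sq (z w : 𝔻) : 1 - rho z w ^ 2 =
    (1 - ‖(z : ℂ)‖ ^ 2) * (1 - ‖(w : ℂ)‖ ^ 2) / ‖1 - conj (w : ℂ) * z‖ ^ 2 := by
  have h : ‖1 - conj (w : ℂ) * z‖ ≠ 0 := norm_ne_zero_iff.2 (one_sub_conj_mul_ne_zero w z)
  rw [rho_eq, norm_div, div_pow, eq_div_iff (pow_ne_zero 2 h), sub_mul,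
    div_mul_cancel₀ _ (pow_ne_zero 2 h), norm_one_sub_conj_mul_sq]
  ring

theorem one_sub_rho_sq_pos (z w : 𝔻) : 0 < 1 - rho z w ^ 2 := by
  nlinarith [rho_nonneg z w, rho_lt_one z w]

theorem one_sub_norm_mobius_sq (w z : 𝔻) : 1 - ‖(mobius w z : ℂ)‖ ^ 2 =
    (1 - ‖(z : ℂ)‖ ^ 2) * (1 - ‖(w : ℂ)‖ ^ 2) / ‖1 + conj (w : ℂ) * z‖ ^ 2 := by
  simpa [rho, sub_eq_add_neg] using one_sub_rho_sq z (-w)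

theorem rho_mobius (w z u : 𝔻) : rho (mobius w z) (mobius w u) = rho z u := by
  have h : 1 - conj (mobius w u : ℂ) * mobius w z =
      (1 - ‖(w : ℂ)‖ ^ 2 : ℝ) * (1 - conj (u : ℂ) * z) /
        ((1 + w * conj (u : ℂ)) * (1 + conj (w : ℂ) * z)) := by
    have h1 := one_add_conj_mul_ne_zero w z
    have h2 := one_add_mul_conj_ne_zero w u
    have h3 : ((1 - ‖(w : ℂ)‖ ^ 2 : ℝ) : ℂ) = 1 - w * conj (w : ℂ) := by
      rw [Complex.mul_conj']; push_cast; ring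
    rw [h3, coe_mobius, coe_mobius]
    simp only [map_div₀, map_add, map_mul, Complex.conj_conj, map_one]
    rw [div_mul_div_comm, eq_div_iff (mul_ne_zero h2 h1), sub_mul,
      div_mul_cancel₀ _ (mul_ne_zero h2 h1)]
    ring
  have e : 1 - rho (mobius w z) (mobius w u) ^ 2 = 1 - rho z u ^ 2 := by
    rw [one_sub_rho_sq, one_sub_rho_sq, one_sub_norm_mobius_sq, one_sub_norm_mobius_sq, h]
    have h1 := norm_ne_zero_iff.2 (one_add_conj_mul_ne_zero w z)
    have h2 := norm_ne_zero_iff.2 (one_add_mul_conj_ne_zero w u)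
    have h3 := norm_ne_zero_iff.2 (one_sub_conj_mul_ne_zero u z)
    have h4 := (one_sub_sq_pos w).ne'
    have h5 : ‖1 + conj (w : ℂ) * u‖ = ‖1 + (w : ℂ) * conj (u : ℂ)‖ := by
      rw [← Complex.norm_conj]; simp
    rw [norm_div, norm_mul, norm_mul, Complex.norm_real, Real.norm_of_nonneg (one_sub_sq_pos w).le,
      h5]
    field_simp
  have := (sq_eq_sq₀ (rho_nonneg (mobius w z) (mobius w u)) (rho_nonneg z u)).1 (by linarith)
  exact this

/-- The Möbius maps compose up to the rotation `λ`: `L_w (L_v (λ z)) = L_{L_w v} z` with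
`λ = (1 + conj w * v) / (1 + w * conj v)`. -/
theorem mobius_mobius (w v z : 𝔻) :
    mobius w (mobius v (unimodularQuotient (.mk w w.norm_lt_one.le) v • z)) =
      mobius (mobius w v) z := by
  apply Complex.UnitDisc.coe_injective
  have h1 := one_add_conj_mul_ne_zero w v
  have h2 := one_add_mul_conj_ne_zero w v
  have h3 := one_add_conj_mul_ne_zero v (unimodularQuotient (.mk w w.norm_lt_one.le) v • z)
  have h4 := one_add_conj_mul_ne_zero w
    (mobius v (unimodularQuotient (.mk w w.norm_lt_one.le) v • z))
  have h5 := one_add_conj_mul_ne_zero (mobius w v) z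
  have hq : ((unimodularQuotient (.mk w w.norm_lt_one.le) v : Circle) : ℂ) =
    (1 + conj (w : ℂ) * v) / (1 + (w : ℂ) * conj (v : ℂ)) := rfl
  simp only [coe_mobius, Complex.UnitDisc.coe_circle_smul, hq, map_div₀, map_add, map_mul,
    Complex.conj_conj, map_one] at *
  clear hq
  -- Conjugates are now independent variables, and what remains is an identity of fractions.
  generalize (conj (w : ℂ)) = w' at *
  generalize (conj (v : ℂ)) = v' at *
  have hq : (1 + w' * v) / (1 + w * v') * (1 + w * v') = 1 + w' * (v : ℂ) := div_mul_cancel₀ _ h2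
  have hp : ((v : ℂ) + w) / (1 + w' * v) * (1 + w' * v) = v + w := div_mul_cancel₀ _ h1
  have hp' : (v' + w') / (1 + w * v') * (1 + w * v') = v' + w' := div_mul_cancel₀ _ h2
  generalize (1 + w' * v) / (1 + w * v') = q at *
  have h6 : 1 + v' * (q * z) + w' * (q * z + v) =
      (1 + w' * v) * (1 + (v' + w') / (1 + w * v') * z) := by
    linear_combination (v' + w') / (1 + w * v') * z * hq - q * z * hp'
  have h7 : (1 + v' * (q * z)) * (1 + w' * ((q * z + v) / (1 + v' * (q * z)))) =
      1 + v' * (q * z) + w' * (q * z + v) := by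
    linear_combination w' * div_mul_cancel₀ (q * z + v) h3
  rw [← mul_div_mul_left _ _ h3, h7, h6, ← mul_div_mul_left (_ + _ / _) _ h1]
  congr 1
  linear_combination div_mul_cancel₀ (q * z + v) h3 + z * hq - hp

theorem mobius_neg_mobius (w z : 𝔻) : mobius (-w) (mobius w z) = z := by
  apply Complex.UnitDisc.coe_injective
  have h1 := one_add_conj_mul_ne_zero w z
  have h2 := one_add_conj_mul_ne_zero (-w) (mobius w z)
  rw [coe_mobius, div_eq_iff h2]
  simp only [coe_mobius, Complex.UnitDisc.coe_neg, map_neg]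
  linear_combination div_mul_cancel₀ ((z : ℂ) + w) h1

theorem mobius_mobius_neg (w z : 𝔻) : mobius w (mobius (-w) z) = z := by
  simpa using mobius_neg_mobius (-w) z

theorem mobius_zero (w : 𝔻) : mobius w 0 = w := by
  apply Complex.UnitDisc.coe_injective; simp [coe_mobius]

/-- Harnack's inequality for the kernel `1 - rho ^ 2`. -/
theorem one_sub_rho_sq_le {A : ℝ} (hA : A < 1) {p q : 𝔻} (hpq : rho p q ≤ A) (u : 𝔻) :
    1 - rho p u ^ 2 ≤ (1 + A) / (1 - A) * (1 - rho q u ^ 2) := by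
  wlog hq : q = 0 generalizing p q u
  · have := this (p := mobius (-q) p) (q := mobius (-q) q) (by rwa [rho_mobius]) (mobius (-q) u)
      (Complex.UnitDisc.coe_injective (by simp [coe_mobius]))
    rwa [rho_mobius, rho_mobius] at this
  subst hq
  rw [rho_zero] at hpq
  have h1 : 1 - ‖(p : ℂ)‖ ≤ ‖1 - conj (u : ℂ) * p‖ := by
    have := norm_sub_norm_le (1 : ℂ) (conj (u : ℂ) * p)
    rw [norm_one, norm_mul, Complex.norm_conj] at this
    nlinarith [u.norm_lt_one, norm_nonneg (p : ℂ)]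
  have hp := p.norm_lt_one
  have hA1 : 0 < 1 - A := by linarith
  rw [one_sub_rho_sq, rho_comm, rho_zero]
  have h2 : (1 - ‖(p : ℂ)‖ ^ 2) * (1 - ‖(u : ℂ)‖ ^ 2) / ‖1 - conj (u : ℂ) * p‖ ^ 2 ≤
      (1 - ‖(p : ℂ)‖ ^ 2) * (1 - ‖(u : ℂ)‖ ^ 2) / (1 - ‖(p : ℂ)‖) ^ 2 := by
    have := one_sub_sq_pos p
    have := one_sub_sq_pos u
    have : 0 < 1 - ‖(p : ℂ)‖ := by linarith
    gcongr
  refine h2.trans ?_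
  have : (1 - ‖(p : ℂ)‖ ^ 2) * (1 - ‖(u : ℂ)‖ ^ 2) / (1 - ‖(p : ℂ)‖) ^ 2 =
      (1 + ‖(p : ℂ)‖) / (1 - ‖(p : ℂ)‖) * (1 - ‖(u : ℂ)‖ ^ 2) := by
    have : 1 - ‖(p : ℂ)‖ ≠ 0 := by linarith
    generalize ‖(p : ℂ)‖ = a at *
    field_simp
    ring
  rw [this]
  have := (one_sub_sq_pos u).le
  have := (norm_nonneg (p : ℂ)).trans hpq
  gcongr

theorem rho_le_norm_sub_div (u z : 𝔻) : rho u z ≤ ‖(u : ℂ) - z‖ / (1 - ‖(z : ℂ)‖) := by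
  have hz := z.norm_lt_one
  have h1 : 1 - ‖(z : ℂ)‖ ≤ ‖1 - conj (z : ℂ) * u‖ := by
    have := norm_sub_norm_le (1 : ℂ) (conj (z : ℂ) * u)
    rw [norm_one, norm_mul, Complex.norm_conj] at this
    nlinarith [u.norm_lt_one, norm_nonneg (z : ℂ)]
  rw [rho_eq, norm_div]
  have : 0 < 1 - ‖(z : ℂ)‖ := by linarith
  gcongr

/-- The images of `z` under `L_w` and `L_p` are close when `w` and `p` are, uniformly in `w`
and `p`. -/
theorem rho_mobius_mobius_le (w p z : 𝔻) (h : rho p w ≤ 1 / 2) :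
    rho (mobius w z) (mobius p z) ≤ 12 / (1 - ‖(z : ℂ)‖) * rho p w := by
  -- `L_p z = L_w (L_ξ (l z))` with `ξ = L_{-w} p` small and `l` a rotation close to the identity.
  set ξ := mobius (-w) p with hξ
  have hp : p = mobius w ξ := (mobius_mobius_neg w p).symm
  have hr : rho p w = ‖(ξ : ℂ)‖ := rfl
  rw [hr] at h ⊢
  set l := unimodularQuotient (.mk w w.norm_lt_one.le) ξ with hl
  rw [hp, ← mobius_mobius, ← hl, rho_mobius, rho_comm]
  refine (rho_le_norm_sub_div _ _).trans ?_
  have hz : 0 < 1 - ‖(z : ℂ)‖ := sub_pos.2 z.norm_lt_one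
  rw [div_mul_eq_mul_div]
  gcongr
  have hw1 : (1 : ℝ) / 2 ≤ ‖1 + (w : ℂ) * conj (ξ : ℂ)‖ := by
    have := norm_sub_norm_le (1 : ℂ) (-((w : ℂ) * conj (ξ : ℂ)))
    rw [norm_one, norm_neg, norm_mul, Complex.norm_conj, sub_neg_eq_add] at this
    nlinarith [w.norm_lt_one, norm_nonneg (ξ : ℂ)]
  have hl1 : ‖(l : ℂ) - 1‖ ≤ 4 * ‖(ξ : ℂ)‖ := by
    have h0 : (l : ℂ) = (1 + conj (w : ℂ) * ξ) / (1 + (w : ℂ) * conj (ξ : ℂ)) := rfl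
    have h1 : (l : ℂ) - 1 = (conj (w : ℂ) * ξ - w * conj (ξ : ℂ)) / (1 + w * conj (ξ : ℂ)) := by
      rw [h0]
      have := one_add_mul_conj_ne_zero w ξ
      field_simp
      ring
    have h2 : ‖conj (w : ℂ) * ξ - w * conj (ξ : ℂ)‖ ≤ 2 * ‖(ξ : ℂ)‖ := by
      refine (norm_sub_le _ _).trans ?_
      rw [norm_mul, norm_mul, Complex.norm_conj, Complex.norm_conj]
      nlinarith [w.norm_lt_one, norm_nonneg (ξ : ℂ)]
    rw [h1, norm_div, div_le_iff₀ (by linarith)]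
    nlinarith [norm_nonneg (ξ : ℂ)]
  set u := l • z with hu
  have hu1 : (u : ℂ) = l * z := rfl
  have hd : (1 : ℝ) / 2 ≤ ‖1 + conj (ξ : ℂ) * u‖ := by
    have := norm_sub_norm_le (1 : ℂ) (-(conj (ξ : ℂ) * u))
    rw [norm_one, norm_neg, norm_mul, Complex.norm_conj, sub_neg_eq_add] at this
    nlinarith [u.norm_lt_one, norm_nonneg (ξ : ℂ)]
  have h3 : (mobius ξ u : ℂ) - z =
      ((l - 1) * z + (ξ - conj (ξ : ℂ) * u * z)) / (1 + conj (ξ : ℂ) * u) := by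
    rw [coe_mobius, eq_div_iff (one_add_conj_mul_ne_zero ξ u), sub_mul,
      div_mul_cancel₀ _ (one_add_conj_mul_ne_zero ξ u), hu1]
    ring
  rw [h3, norm_div, div_le_iff₀ (by linarith)]
  have h4 : ‖((l : ℂ) - 1) * z + (ξ - conj (ξ : ℂ) * u * z)‖ ≤ 6 * ‖(ξ : ℂ)‖ := by
    refine (norm_add_le _ _).trans ?_
    have h5 : ‖((l : ℂ) - 1) * z‖ ≤ 4 * ‖(ξ : ℂ)‖ := by
      rw [norm_mul]
      nlinarith [z.norm_lt_one, norm_nonneg (z : ℂ), norm_nonneg ((l : ℂ) - 1)]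
    have h6 : ‖(ξ : ℂ) - conj (ξ : ℂ) * u * z‖ ≤ 2 * ‖(ξ : ℂ)‖ := by
      refine (norm_sub_le _ _).trans ?_
      rw [mul_assoc, norm_mul, Complex.norm_conj]
      have : ‖(u : ℂ) * z‖ ≤ 1 := by
        rw [norm_mul]
        exact mul_le_one₀ u.norm_lt_one.le (norm_nonneg _) z.norm_lt_one.le
      nlinarith [norm_nonneg (ξ : ℂ)]
    linarith
  nlinarith [norm_nonneg (ξ : ℂ)]

/-! ### Bounded analytic functions: composition, the Schwarz lemma, division -/

theorem norm_val_le (f : Hinf) (z : 𝔻) : ‖f.1 z‖ ≤ ‖f‖ := f.1.norm_coe_le_norm z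

theorem mul_val (f g : Hinf) (z : 𝔻) : (f * g).1 z = f.1 z * g.1 z := rfl

theorem add_val (f g : Hinf) (z : 𝔻) : (f + g).1 z = f.1 z + g.1 z := rfl

theorem sub_val (f g : Hinf) (z : 𝔻) : (f - g).1 z = f.1 z - g.1 z := rfl

theorem one_val (z : 𝔻) : (1 : Hinf).1 z = 1 := rfl

theorem algebraMap_val (c : ℂ) (z : 𝔻) : (algebraMap ℂ Hinf c).1 z = c := rfl

theorem smul_val (c : ℂ) (f : Hinf) (z : 𝔻) : (c • f).1 z = c * f.1 z := rfl

theorem sum_val {ι : Type*} (s : Finset ι) (f : ι → Hinf) (z : 𝔻) :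
    (∑ i ∈ s, f i).1 z = ∑ i ∈ s, (f i).1 z := by
  induction s using Finset.cons_induction with
  | empty => rfl
  | cons a s ha ih => rw [Finset.sum_cons, Finset.sum_cons, add_val, ih]

theorem prod_val {ι : Type*} (s : Finset ι) (f : ι → Hinf) (z : 𝔻) :
    (∏ i ∈ s, f i).1 z = ∏ i ∈ s, (f i).1 z := by
  induction s using Finset.cons_induction with
  | empty => rfl
  | cons a s ha ih => rw [Finset.prod_cons, Finset.prod_cons, mul_val, ih]

theorem norm_le_of_forall {f : Hinf} {C : ℝ} (hC : 0 ≤ C) (h : ∀ z, ‖f.1 z‖ ≤ C) : ‖f‖ ≤ C :=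
  (BoundedContinuousFunction.norm_le hC).2 h

/-- The element of `H^∞` given by a function analytic and bounded on the unit disc. -/
noncomputable def ofFun (g : ℂ → ℂ) (hg : DifferentiableOn ℂ g (Metric.ball 0 1)) (C : ℝ)
    (hC : ∀ z : 𝔻, ‖g z‖ ≤ C) : Hinf :=
  ⟨BoundedContinuousFunction.ofNormedAddCommGroup (fun z : 𝔻 => g z)
    (hg.continuousOn.comp_continuous Complex.UnitDisc.continuous_coe
      fun z => mem_ball_zero_iff.2 z.norm_lt_one) C hC, g, hg, fun _ => rfl⟩

theorem ofFun_val (g : ℂ → ℂ) (hg : DifferentiableOn ℂ g (Metric.ball 0 1)) (C : ℝ)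
    (hC : ∀ z : 𝔻, ‖g z‖ ≤ C) (z : 𝔻) : (ofFun g hg C hC).1 z = g z := rfl

theorem differentiableOn_mobius (w : 𝔻) :
    DifferentiableOn ℂ (fun z : ℂ => (z + w) / (1 + conj (w : ℂ) * z)) (Metric.ball 0 1) :=
  (by fun_prop : DifferentiableOn ℂ (fun z : ℂ => z + w) _).div (by fun_prop) fun z hz =>
    one_add_conj_mul_ne_zero w (.mk z (mem_ball_zero_iff.1 hz))

/-- The Blaschke factor `z ↦ (z - a) / (1 - conj a * z)`. -/
noncomputable def blaschke (a : 𝔻) : Hinf :=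
  ofFun (fun z : ℂ => (z + (-a : 𝔻)) / (1 + conj ((-a : 𝔻) : ℂ) * z)) (differentiableOn_mobius (-a))
    1 fun z => (mobius (-a) z).norm_lt_one.le

theorem blaschke_val (a z : 𝔻) : (blaschke a).1 z = mobius (-a) z := rfl

theorem norm_blaschke_val (a z : 𝔻) : ‖(blaschke a).1 z‖ = rho z a := rfl

theorem blaschke_val_eq_zero {a z : 𝔻} : (blaschke a).1 z = 0 ↔ z = a := by
  rw [← norm_eq_zero, norm_blaschke_val, rho_eq_zero]

theorem exists_comp_mobius (w : 𝔻) (f : Hinf) : ∃ g : Hinf, ∀ z, g.1 z = f.1 (mobius w z) := by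
  obtain ⟨g, hg, hgf⟩ := f.2
  refine ⟨ofFun (fun z => g ((z + w) / (1 + conj (w : ℂ) * z)))
    (hg.comp (differentiableOn_mobius w) fun z hz => ?_) ‖f‖ fun z => ?_, fun z => ?_⟩
  · exact mem_ball_zero_iff.2 (mobius w (.mk z (mem_ball_zero_iff.1 hz))).norm_lt_one
  · have := hgf (mobius w z)
    rw [coe_mobius] at this
    rw [this]
    exact norm_val_le f _
  · have := hgf (mobius w z)
    rw [coe_mobius] at this
    rw [ofFun_val, this]

/-- The composition `f ∘ L_w`. -/
noncomputable def comp (w : 𝔻) (f : Hinf) : Hinf := (exists_comp_mobius w f).choose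

theorem comp_val (w : 𝔻) (f : Hinf) (z : 𝔻) : (comp w f).1 z = f.1 (mobius w z) :=
  (exists_comp_mobius w f).choose_spec z

theorem norm_comp_le (w : 𝔻) (f : Hinf) : ‖comp w f‖ ≤ ‖f‖ :=
  norm_le_of_forall (norm_nonneg f) fun z => by rw [comp_val]; exact norm_val_le f _

/-- The Schwarz–Pick lemma. -/
theorem norm_sub_le_rho (f : Hinf) (z w : 𝔻) : ‖f.1 z - f.1 w‖ ≤ 2 * ‖f‖ * rho z w := by
  wlog hw : w = 0 generalizing f z w
  · have := this (comp w f) (mobius (-w) z) 0 rfl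
    rw [comp_val, comp_val, mobius_mobius_neg, mobius_zero, rho_zero] at this
    exact this.trans (mul_le_mul_of_nonneg_right
      (mul_le_mul_of_nonneg_left (norm_comp_le w f) zero_le_two) (norm_nonneg _))
  subst hw
  obtain ⟨g, hg, hgf⟩ := f.2
  have h := Complex.dist_le_div_mul_dist_of_mapsTo_ball (R₂ := 2 * ‖f‖) hg (fun u hu => ?_)
    (mem_ball_zero_iff.2 z.norm_lt_one)
  · rw [hgf z, div_one, dist_zero_right, dist_eq_norm] at h
    have h0 := hgf 0
    rw [Complex.UnitDisc.coe_zero] at h0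
    rw [h0] at h
    rwa [rho_zero]
  · have h0 := hgf 0
    have h1 := hgf (.mk u (mem_ball_zero_iff.1 hu))
    rw [Complex.UnitDisc.coe_zero] at h0
    rw [Complex.UnitDisc.coe_mk] at h1
    rw [Metric.mem_closedBall, dist_eq_norm, h0, h1, two_mul]
    exact (norm_sub_le _ _).trans (add_le_add (norm_val_le f _) (norm_val_le f _))

/-- A bounded analytic function that vanishes at `a` is divisible by the Blaschke factor of `a`,
without loss of norm. -/
theorem exists_eq_blaschke_mul (f : Hinf) (a : 𝔻) (ha : f.1 a = 0) :
    ∃ k : Hinf, ‖k‖ ≤ ‖f‖ ∧ f = blaschke a * k := by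
  suffices H : ∀ f : Hinf, f.1 0 = 0 → ∃ k : Hinf, ‖k‖ ≤ ‖f‖ ∧ ∀ z : 𝔻, f.1 z = z * k.1 z by
    obtain ⟨k, hk, hkf⟩ := H (comp a f) (by rw [comp_val, mobius_zero, ha])
    refine ⟨comp (-a) k, (norm_comp_le _ _).trans (hk.trans (norm_comp_le _ _)),
      hinf_ext fun z => ?_⟩
    have := hkf (mobius (-a) z)
    rw [comp_val, mobius_mobius_neg] at this
    rw [this, mul_val, blaschke_val, comp_val]
  intro f h0
  obtain ⟨g, hg, hgf⟩ := f.2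
  have hg0 : g 0 = 0 := by
    have := hgf 0
    rw [Complex.UnitDisc.coe_zero] at this
    rw [this]; exact h0
  have hmaps : Set.MapsTo g (Metric.ball 0 1) (Metric.closedBall (g 0) ‖f‖) := fun u hu => by
    have h1 := hgf (.mk u (mem_ball_zero_iff.1 hu))
    rw [Complex.UnitDisc.coe_mk] at h1
    rw [Metric.mem_closedBall, dist_eq_norm, hg0, h1, sub_zero]
    exact norm_val_le f _
  have hb : ∀ z : 𝔻, ‖dslope g 0 z‖ ≤ ‖f‖ := fun z =>
    (Complex.norm_dslope_le_div_of_mapsTo_ball hg hmaps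
      (mem_ball_zero_iff.2 z.norm_lt_one)).trans_eq (div_one _)
  refine ⟨ofFun (dslope g 0) ((Complex.differentiableOn_dslope
    (Metric.ball_mem_nhds 0 one_pos)).2 hg) ‖f‖ hb, norm_le_of_forall (norm_nonneg f) hb,
    fun z => ?_⟩
  have := sub_smul_dslope g 0 (z : ℂ)
  rw [sub_zero, hg0, sub_zero, hgf, smul_eq_mul] at this
  exact this.symm

theorem exists_eq_prod_blaschke_mul (S : Finset 𝔻) (f : Hinf) (hf : ∀ a ∈ S, f.1 a = 0) :
    ∃ k : Hinf, ‖k‖ ≤ ‖f‖ ∧ f = (∏ a ∈ S, blaschke a) * k := by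
  classical
  induction S using Finset.induction_on with
  | empty => exact ⟨f, le_rfl, by simp⟩
  | insert b S hb ih =>
    obtain ⟨k, hk, hkf⟩ := ih fun a ha => hf a (Finset.mem_insert_of_mem ha)
    have hkb : k.1 b = 0 := by
      have h := hf b (Finset.mem_insert_self _ _)
      rw [hkf, mul_val, mul_eq_zero, prod_val, Finset.prod_eq_zero_iff] at h
      refine h.resolve_left ?_
      rintro ⟨a, ha, hab⟩
      rw [blaschke_val_eq_zero] at hab
      exact hb (hab ▸ ha)
    obtain ⟨l, hl, hlk⟩ := exists_eq_blaschke_mul k b hkb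
    exact ⟨l, hl.trans hk, by rw [hkf, hlk, Finset.prod_insert hb]; ring⟩

theorem norm_prod_blaschke_val (S : Finset 𝔻) (z : 𝔻) :
    ‖(∏ a ∈ S, blaschke a).1 z‖ = ∏ a ∈ S, rho z a := by
  rw [prod_val, norm_prod]; rfl

theorem norm_prod_blaschke_le (S : Finset 𝔻) : ‖∏ a ∈ S, blaschke a‖ ≤ 1 :=
  norm_le_of_forall zero_le_one fun z => by
    rw [norm_prod_blaschke_val]
    exact Finset.prod_le_one (fun a _ => rho_nonneg z a) fun a _ => (rho_lt_one z a).le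

/-! ### Interpolation on uniformly separated finite sets -/

open Classical in
/-- A finite subset `S` of the disc is uniformly separated with constant `δ` if
`∏_{b ∈ S, b ≠ a} rho a b ≥ δ` for every `a ∈ S`. -/
def IsUniformlySeparated (δ : ℝ) (S : Finset 𝔻) : Prop :=
  ∀ a ∈ S, δ ≤ ∏ b ∈ S.erase a, rho a b

open Classical in
/-- The additive form of uniform separation, obtained from `1 - x ^ 2 ≤ -2 log x`. -/
theorem IsUniformlySeparated.sum_le {δ : ℝ} (hδ : 0 < δ) {S : Finset 𝔻}
    (hS : IsUniformlySeparated δ S) {a : 𝔻} (ha : a ∈ S) :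
    ∑ b ∈ S.erase a, (1 - rho a b ^ 2) ≤ -2 * Real.log δ := by
  have hpos : ∀ b ∈ S.erase a, 0 < rho a b := fun b hb =>
    (rho_nonneg a b).lt_of_ne' fun h => (Finset.ne_of_mem_erase hb) (rho_eq_zero.1 h).symm
  have h1 : Real.log δ ≤ ∑ b ∈ S.erase a, Real.log (rho a b) := by
    rw [← Real.log_prod fun b hb => (hpos b hb).ne']
    exact Real.log_le_log hδ (hS a ha)
  have h2 : ∑ b ∈ S.erase a, (1 - rho a b ^ 2) ≤ ∑ b ∈ S.erase a, -2 * Real.log (rho a b) :=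
    Finset.sum_le_sum fun b hb => by
      have := Real.log_le_sub_one_of_pos (pow_pos (hpos b hb) 2)
      rw [Real.log_pow] at this
      push_cast at this
      linarith
  rw [← Finset.mul_sum] at h2
  linarith

/-- A discrete form of `∫ e ^ (-s) ds ≤ 1`. -/
theorem sum_mul_exp_neg_le {ι : Type*} (S : Finset ι) (r t : ι → ℝ) (ht : ∀ i, 0 ≤ t i) :
    ∑ j ∈ S, t j * Real.exp (-∑ k ∈ S with r j ≤ r k, t k) ≤ 1 - Real.exp (-∑ k ∈ S, t k) := by
  classical
  induction S using Finset.induction_on_min_value r with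
  | empty => simp
  | insert a S ha hmin ih =>
    rw [Finset.sum_insert ha, Finset.sum_insert ha]
    have h1 : (insert a S).filter (fun k => r a ≤ r k) = insert a S :=
      Finset.filter_true_of_mem fun k hk => by
        rcases Finset.mem_insert.1 hk with rfl | hk
        exacts [le_rfl, hmin k hk]
    rw [h1, Finset.sum_insert ha]
    have h2 : ∑ j ∈ S, t j * Real.exp (-∑ k ∈ insert a S with r j ≤ r k, t k) ≤
        ∑ j ∈ S, t j * Real.exp (-∑ k ∈ S with r j ≤ r k, t k) :=
      Finset.sum_le_sum fun j _ => by
        refine mul_le_mul_of_nonneg_left (Real.exp_le_exp.2 (neg_le_neg ?_)) (ht j)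
        exact Finset.sum_le_sum_of_subset_of_nonneg
          (Finset.filter_subset_filter _ (Finset.subset_insert _ _)) fun k _ _ => ht k
    set T := ∑ k ∈ S, t k
    have h3 : Real.exp (-T) = Real.exp (-(t a + T)) * Real.exp (t a) := by
      rw [← Real.exp_add]; congr 1; ring
    have h4 := Real.add_one_le_exp (t a)
    have h5 := Real.exp_pos (-(t a + T))
    nlinarith

theorem re_one_add_div_one_sub (u : ℂ) :
    ((1 + u) / (1 - u)).re = (1 - ‖u‖ ^ 2) / ‖1 - u‖ ^ 2 := by
  rw [Complex.div_re, Complex.sq_norm, Complex.sq_norm, ← add_div]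
  congr 1
  simp [Complex.normSq_apply]
  ring

/-- The constant of interpolation for uniformly separated sets. -/
noncomputable def interpConst (δ : ℝ) : ℝ := Real.exp (2 - 4 * Real.log δ) / δ

theorem interpConst_pos {δ : ℝ} (hδ : 0 < δ) : 0 < interpConst δ := div_pos (Real.exp_pos _) hδ

/-- The weight of the point `b` in P. Jones's interpolation formula: `(1 - |b| ^ 2) ^ 2` divided by
`|1 - conj b * z| ^ 2`. -/
noncomputable def jonesWeight (z b : 𝔻) : ℝ :=
  ((1 - ‖(b : ℂ)‖ ^ 2) / ‖1 - conj (b : ℂ) * z‖) ^ 2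

theorem jonesWeight_nonneg (z b : 𝔻) : 0 ≤ jonesWeight z b := sq_nonneg _

theorem jonesWeight_le (z b : 𝔻) : jonesWeight z b ≤
    (1 - ‖(b : ℂ)‖ ^ 2) * ((1 + conj (b : ℂ) * z) / (1 - conj (b : ℂ) * z)).re := by
  have hb := one_sub_sq_pos b
  have : 1 - ‖(b : ℂ)‖ ^ 2 ≤ 1 - ‖conj (b : ℂ) * z‖ ^ 2 := by
    rw [norm_mul, Complex.norm_conj]
    nlinarith [mul_le_mul_of_nonneg_left z.sq_norm_lt_one.le (sq_nonneg ‖(b : ℂ)‖)]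
  rw [re_one_add_div_one_sub, jonesWeight, div_pow, pow_two (1 - _), mul_div_assoc]
  gcongr

theorem mul_re_le_of_norm_le {a b : 𝔻} (hab : ‖(a : ℂ)‖ ≤ ‖(b : ℂ)‖) :
    (1 - ‖(b : ℂ)‖ ^ 2) * ((1 + conj (b : ℂ) * a) / (1 - conj (b : ℂ) * a)).re ≤
      2 * (1 - rho a b ^ 2) := by
  have ha := one_sub_sq_pos a
  have hb := one_sub_sq_pos b
  have : 1 - ‖conj (b : ℂ) * a‖ ^ 2 ≤ 2 * (1 - ‖(a : ℂ)‖ ^ 2) := by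
    rw [norm_mul, Complex.norm_conj]
    have h1 : ‖(a : ℂ)‖ ^ 2 ≤ ‖(b : ℂ)‖ ^ 2 := by gcongr
    nlinarith [sq_nonneg ‖(a : ℂ)‖]
  rw [re_one_add_div_one_sub, one_sub_rho_sq, ← mul_div_assoc, ← mul_div_assoc]
  gcongr ?_ / _
  nlinarith

open Classical in
/-- P. Jones's explicit interpolating functions for a uniformly separated finite set. The
exponential factor, which involves only the points `b` with `|b| ≥ |a|`, makes the sum of the
moduli over all `a` bounded, by `sum_mul_exp_neg_le`. -/
theorem exists_jones_function {δ : ℝ} (hδ : 0 < δ) {S : Finset 𝔻}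
    (hS : IsUniformlySeparated δ S) {a : 𝔻} (ha : a ∈ S) :
    ∃ F : Hinf, F.1 a = 1 ∧ (∀ b ∈ S.erase a, F.1 b = 0) ∧ ∀ z : 𝔻, ‖F.1 z‖ ≤
      interpConst δ * (jonesWeight z a *
        Real.exp (-∑ b ∈ S with ‖(a : ℂ)‖ ≤ ‖((b : 𝔻) : ℂ)‖, jonesWeight z b)) := by
  set T := S.filter fun b : 𝔻 => ‖(a : ℂ)‖ ≤ ‖(b : ℂ)‖ with hT
  let q : ℂ → ℂ → ℂ := fun b z => (1 + conj b * z) / (1 - conj b * z)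
  let e : ℂ → ℂ := fun z => ((1 - ‖(a : ℂ)‖ ^ 2 : ℝ) / (1 - conj (a : ℂ) * z)) ^ 2 *
    Complex.exp (-∑ b ∈ T, (1 - ‖(b : ℂ)‖ ^ 2 : ℝ) * (q b z - q b a))
  have hne : ∀ (b : 𝔻), ∀ z ∈ Metric.ball (0 : ℂ) 1, 1 - conj (b : ℂ) * z ≠ 0 := fun b z hz =>
    one_sub_conj_mul_ne_zero b (.mk z (mem_ball_zero_iff.1 hz))
  have hq : ∀ b : 𝔻, DifferentiableOn ℂ (q b) (Metric.ball 0 1) := fun b =>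
    (by fun_prop : DifferentiableOn ℂ (fun z : ℂ => 1 + conj (b : ℂ) * z) _).div (by fun_prop)
      (hne b)
  have he : DifferentiableOn ℂ e (Metric.ball 0 1) := by
    refine DifferentiableOn.mul (((differentiableOn_const _).div (by fun_prop) (hne a)).pow 2)
      (DifferentiableOn.cexp (DifferentiableOn.neg (DifferentiableOn.fun_sum fun b _ => ?_)))
    exact ((hq b).sub_const _).const_mul _
  -- The terms at `z` dominate the weights, and those at `a` are bounded through separation.
  have hre : ∀ z : 𝔻, (-∑ b ∈ T, ((1 - ‖(b : ℂ)‖ ^ 2 : ℝ) : ℂ) * (q b z - q b a)).re ≤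
      (2 - 4 * Real.log δ) + -∑ b ∈ T, jonesWeight z b := by
    intro z
    have h1 : ∑ b ∈ T, (1 - ‖(b : ℂ)‖ ^ 2) * (q b a).re ≤ 2 - 4 * Real.log δ := by
      calc ∑ b ∈ T, (1 - ‖(b : ℂ)‖ ^ 2) * (q b a).re
          ≤ ∑ b ∈ T, 2 * (1 - rho a b ^ 2) := Finset.sum_le_sum fun b hb =>
            mul_re_le_of_norm_le (Finset.mem_filter.1 hb).2
        _ ≤ ∑ b ∈ S, 2 * (1 - rho a b ^ 2) :=
            Finset.sum_le_sum_of_subset_of_nonneg (Finset.filter_subset _ _) fun b _ _ =>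
              mul_nonneg zero_le_two (one_sub_rho_sq_pos a b).le
        _ ≤ 2 - 4 * Real.log δ := by
            rw [← Finset.mul_sum, ← Finset.add_sum_erase _ _ ha, rho_self]
            have := hS.sum_le hδ ha
            linarith
    have h2 : ∑ b ∈ T, jonesWeight z b ≤ ∑ b ∈ T, (1 - ‖(b : ℂ)‖ ^ 2) * (q b z).re :=
      Finset.sum_le_sum fun b _ => jonesWeight_le z b
    simp only [Complex.neg_re, Complex.re_sum, Complex.re_ofReal_mul, Complex.sub_re, mul_sub,
      Finset.sum_sub_distrib]
    linarith
  have hnorm : ∀ z : 𝔻, ‖e z‖ ≤ Real.exp (2 - 4 * Real.log δ) *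
      (jonesWeight z a * Real.exp (-∑ b ∈ T, jonesWeight z b)) := by
    intro z
    have h1 : ‖e z‖ = jonesWeight z a *
        Real.exp (-∑ b ∈ T, ((1 - ‖(b : ℂ)‖ ^ 2 : ℝ) : ℂ) * (q b z - q b a)).re := by
      rw [norm_mul, Complex.norm_exp, norm_pow, norm_div, Complex.norm_real,
        Real.norm_of_nonneg (one_sub_sq_pos a).le, jonesWeight]
    rw [h1, mul_left_comm, ← Real.exp_add]
    exact mul_le_mul_of_nonneg_left (Real.exp_le_exp.2 (hre z)) (jonesWeight_nonneg z a)
  have hbd : ∀ z : 𝔻, jonesWeight z a * Real.exp (-∑ b ∈ T, jonesWeight z b) ≤ 1 := fun z => by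
    have h1 := sum_mul_exp_neg_le S (fun b => ‖(b : ℂ)‖) (jonesWeight z) (jonesWeight_nonneg z)
    have h2 := Finset.single_le_sum (f := fun j => jonesWeight z j *
      Real.exp (-∑ k ∈ S with ‖(j : ℂ)‖ ≤ ‖((k : 𝔻) : ℂ)‖, jonesWeight z k))
      (fun j _ => mul_nonneg (jonesWeight_nonneg z j) (Real.exp_pos _).le) ha
    have h3 := Real.exp_pos (-∑ b ∈ S, jonesWeight z b)
    exact h2.trans (h1.trans (by linarith))
  let E : Hinf := ofFun e he (Real.exp (2 - 4 * Real.log δ)) fun z => (hnorm z).trans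
    (mul_le_of_le_one_right (Real.exp_pos _).le (hbd z))
  let P : Hinf := ∏ b ∈ S.erase a, blaschke b
  have hPa : δ ≤ ‖P.1 a‖ := by rw [norm_prod_blaschke_val]; exact hS a ha
  have hPa0 : P.1 a ≠ 0 := norm_pos_iff.1 (hδ.trans_le hPa)
  refine ⟨(P.1 a)⁻¹ • (P * E), ?_, fun b hb => ?_, fun z => ?_⟩
  · have h1 : E.1 a = 1 := by
      have h2 : ((1 - ‖(a : ℂ)‖ ^ 2 : ℝ) : ℂ) = 1 - conj (a : ℂ) * a := by
        rw [Complex.conj_mul']; push_cast; rfl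
      simp only [E, ofFun_val, e, h2, sub_self, mul_zero, Finset.sum_const_zero, neg_zero,
        Complex.exp_zero, mul_one]
      rw [div_self (one_sub_conj_mul_ne_zero a a), one_pow]
    rw [smul_val, mul_val, h1, mul_one, inv_mul_cancel₀ hPa0]
  · have : P.1 b = 0 := by
      rw [prod_val]
      exact Finset.prod_eq_zero hb (blaschke_val_eq_zero.2 rfl)
    rw [smul_val, mul_val, this, zero_mul, mul_zero]
  · rw [smul_val, mul_val, norm_mul, norm_mul, norm_inv, interpConst, div_eq_inv_mul, mul_assoc]
    have h1 : ‖P.1 z‖ ≤ 1 := (norm_val_le P z).trans (norm_prod_blaschke_le _)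
    have h2 : ‖E.1 z‖ ≤ _ := hnorm z
    have h3 := mul_le_mul h1 h2 (norm_nonneg _) zero_le_one
    rw [one_mul] at h3
    gcongr

/-- Interpolation on a uniformly separated finite set, with a bound that depends on the constant
of separation only. -/
theorem IsUniformlySeparated.exists_interp {δ : ℝ} (hδ : 0 < δ) {S : Finset 𝔻}
    (hS : IsUniformlySeparated δ S) (c : 𝔻 → ℂ) {C : ℝ} (hC : 0 ≤ C) (hc : ∀ a ∈ S, ‖c a‖ ≤ C) :
    ∃ g : Hinf, ‖g‖ ≤ interpConst δ * C ∧ ∀ a ∈ S, g.1 a = c a := by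
  classical
  choose! F hF1 hF0 hF using fun a ha => exists_jones_function hδ hS (a := a) ha
  refine ⟨∑ a ∈ S, c a • F a, norm_le_of_forall (mul_nonneg (interpConst_pos hδ).le hC)
    fun z => ?_, fun b hb => ?_⟩
  · rw [sum_val]
    calc ‖∑ a ∈ S, (c a • F a).1 z‖ ≤ ∑ a ∈ S, ‖(c a • F a).1 z‖ := norm_sum_le _ _
      _ ≤ ∑ a ∈ S, interpConst δ * C * (jonesWeight z a *
          Real.exp (-∑ b ∈ S with ‖(a : ℂ)‖ ≤ ‖((b : 𝔻) : ℂ)‖, jonesWeight z b)) := by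
        refine Finset.sum_le_sum fun a ha => ?_
        rw [smul_val, norm_mul, mul_comm (interpConst δ), mul_assoc]
        exact mul_le_mul (hc a ha) (hF a ha z) (norm_nonneg _) hC
      _ ≤ interpConst δ * C * 1 := by
        rw [← Finset.mul_sum]
        refine mul_le_mul_of_nonneg_left ?_ (mul_nonneg (interpConst_pos hδ).le hC)
        have h1 := sum_mul_exp_neg_le S (fun b => ‖(b : ℂ)‖) (jonesWeight z)
          (jonesWeight_nonneg z)
        have h3 := Real.exp_pos (-∑ b ∈ S, jonesWeight z b)
        exact h1.trans (by linarith)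
      _ = _ := mul_one _
  · rw [sum_val, Finset.sum_eq_single_of_mem b hb, smul_val, hF1 b hb, mul_one]
    intro a ha hab
    rw [smul_val, hF0 a ha b (Finset.mem_erase.2 ⟨hab.symm, hb⟩), mul_zero]

/-! ### The maximal ideal space -/

theorem tendsto_maxIdeal_iff {ι : Type*} {l : Filter ι} {x : ι → MaxIdeal} {m : MaxIdeal} :
    Tendsto x l (𝓝 m) ↔ ∀ f : Hinf, Tendsto (fun i => x i f) l (𝓝 (m f)) := by
  rw [tendsto_subtype_rng]
  exact tendsto_iff_forall_eval_tendsto_topDualPairing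

theorem tendsto_point_iff {ι : Type*} {l : Filter ι} {w : ι → 𝔻} {m : MaxIdeal} :
    Tendsto (fun i => point (w i)) l (𝓝 m) ↔
      ∀ f : Hinf, Tendsto (fun i => f.1 (w i)) l (𝓝 (m f)) :=
  tendsto_maxIdeal_iff

theorem tendsto_point_toward (m : MaxIdeal) : Tendsto point (toward m) (𝓝 m) := tendsto_comap

theorem tendsto_val_toward (m : MaxIdeal) (f : Hinf) :
    Tendsto (fun w => f.1 w) (toward m) (𝓝 (m f)) :=
  tendsto_point_iff.1 (tendsto_point_toward m) f

theorem maxIdeal_ext {x y : MaxIdeal} (h : ∀ f : Hinf, x f = y f) : x = y :=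
  Subtype.ext (DFunLike.ext _ _ h)

instance : CompactSpace MaxIdeal := by
  refine isCompact_iff_compactSpace.1 ((WeakDual.isCompact_closedBall 0 1).of_isClosed_subset
    WeakDual.CharacterSpace.isClosed fun φ hφ => ?_)
  rw [Set.mem_preimage, mem_closedBall_zero_iff]
  exact ContinuousLinearMap.opNorm_le_bound _ zero_le_one fun f => by
    rw [one_mul]; exact norm_apply_le ⟨φ, hφ⟩ f

/-! ### Limits of bounded analytic functions -/

/-- By the Schwarz–Pick lemma, a bounded family in `H^∞` that converges pointwise converges locally
uniformly. -/
theorem tendstoLocallyUniformlyOn_of_tendsto {ι : Type*} {l : Filter ι} [l.NeBot] {f : ι → Hinf}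
    {C : ℝ} (hC : ∀ i, ‖f i‖ ≤ C) {F : ι → ℂ → ℂ} (hF : ∀ i (z : 𝔻), F i z = (f i).1 z)
    {g : ℂ → ℂ} (hg : ∀ z : 𝔻, Tendsto (fun i => (f i).1 z) l (𝓝 (g z))) :
    TendstoLocallyUniformlyOn F g l (Metric.ball 0 1) := by
  have hC0 : 0 ≤ C := by
    obtain ⟨i⟩ := l.nonempty_of_neBot
    exact (norm_nonneg _).trans (hC i)
  have hi : ∀ i (y x : 𝔻), ‖(f i).1 y - (f i).1 x‖ ≤ 2 * C * rho y x := fun i y x =>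
    (norm_sub_le_rho (f i) y x).trans (by have := rho_nonneg y x; gcongr; exact hC i)
  have hlim : ∀ y x : 𝔻, ‖g y - g x‖ ≤ 2 * C * rho y x := fun y x =>
    le_of_tendsto ((hg y).sub (hg x)).norm (Eventually.of_forall fun i => hi i y x)
  rw [Metric.tendstoLocallyUniformlyOn_iff]
  intro ε hε x hx
  lift x to 𝔻 using mem_ball_zero_iff.1 hx
  have hx1 : 0 < 1 - ‖(x : ℂ)‖ := sub_pos.2 x.norm_lt_one
  have hη : 0 < ε / (16 * (C + 1)) * (1 - ‖(x : ℂ)‖) := by positivity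
  refine ⟨Metric.ball 0 1 ∩ Metric.ball (x : ℂ) _, inter_mem self_mem_nhdsWithin
    (mem_nhdsWithin_of_mem_nhds (Metric.ball_mem_nhds _ hη)), ?_⟩
  filter_upwards [Metric.tendsto_nhds.1 (hg x) (ε / 2) (by positivity)] with i hix y hy
  obtain ⟨hy1, hy2⟩ := hy
  lift y to 𝔻 using mem_ball_zero_iff.1 hy1
  have hr : rho y x ≤ ε / (16 * (C + 1)) := by
    refine (rho_le_norm_sub_div y x).trans ((div_le_iff₀ hx1).2 ?_)
    exact (mem_ball_iff_norm.1 hy2).le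
  have hr2 : 2 * C * rho y x ≤ ε / 8 := by
    have h1 : 2 * C * rho y x ≤ 2 * C * (ε / (16 * (C + 1))) := by gcongr
    have h2 : 2 * C * (ε / (16 * (C + 1))) ≤ ε / 8 := by
      rw [← mul_div_assoc, div_le_iff₀ (by positivity)]
      nlinarith
    linarith
  have h3 := hi i y x
  have h4 := hlim y x
  rw [dist_eq_norm] at hix ⊢
  rw [hF]
  have h5 : g y - (f i).1 y = (g y - g x) - ((f i).1 x - g x) - ((f i).1 y - (f i).1 x) := by ring
  rw [h5]
  refine (norm_sub_le _ _).trans_lt ?_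
  have h6 := norm_sub_le (g y - g x) ((f i).1 x - g x)
  linarith

/-- Montel's theorem: a bounded family in `H^∞` converges, pointwise along a given ultrafilter, to
an element of `H^∞`. -/
theorem exists_tendsto_of_norm_le {ι : Type*} (U : Ultrafilter ι) {f : ι → Hinf} {C : ℝ}
    (hC : ∀ i, ‖f i‖ ≤ C) :
    ∃ g : Hinf, ‖g‖ ≤ C ∧ ∀ z : 𝔻, Tendsto (fun i => (f i).1 z) U (𝓝 (g.1 z)) := by
  have hC0 : 0 ≤ C := by
    obtain ⟨i⟩ := (U : Filter ι).nonempty_of_neBot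
    exact (norm_nonneg _).trans (hC i)
  have h1 : ∀ z : 𝔻, ∃ c : ℂ, ‖c‖ ≤ C ∧ Tendsto (fun i => (f i).1 z) U (𝓝 c) := fun z => by
    obtain ⟨c, hc, hlim⟩ := (isCompact_closedBall (0 : ℂ) C).ultrafilter_le_nhds
      (U.map fun i => (f i).1 z) (by
        refine tendsto_principal.2 (Eventually.of_forall fun i => mem_closedBall_zero_iff.2 ?_)
        exact (norm_val_le _ _).trans (hC i))
    exact ⟨c, mem_closedBall_zero_iff.1 hc, hlim⟩
  choose c hc hlim using h1
  choose F hFd hF using fun i => (f i).2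
  let g : ℂ → ℂ := fun z => if h : ‖z‖ < 1 then c (.mk z h) else 0
  have hg : ∀ z : 𝔻, g z = c z := fun z => by
    simp only [g, dif_pos z.norm_lt_one]
    rfl
  have hd : DifferentiableOn ℂ g (Metric.ball 0 1) :=
    (tendstoLocallyUniformlyOn_of_tendsto hC hF (g := g) fun z => by
      rw [hg]; exact hlim z).differentiableOn (Eventually.of_forall hFd) Metric.isOpen_ball
  have hgC : ∀ z : 𝔻, ‖g z‖ ≤ C := fun z => by rw [hg]; exact hc z
  refine ⟨ofFun g hd C hgC, norm_le_of_forall hC0 hgC, fun z => ?_⟩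
  rw [ofFun_val, hg]
  exact hlim z

/-! ### Interpolating sets and their Blaschke products -/

/-- A subset of the disc all of whose finite subsets are uniformly separated with constant `δ`:
an interpolating sequence. -/
def IsInterpolating (δ : ℝ) (Z : Set 𝔻) : Prop :=
  ∀ S : Finset 𝔻, ↑S ⊆ Z → IsUniformlySeparated δ S

theorem eventually_mem_of_atTop {Z : Set 𝔻} {a : 𝔻} (ha : a ∈ Z) :
    ∀ᶠ t in (Ultrafilter.of (atTop : Filter (Finset Z)) : Filter (Finset Z)),
      a ∈ t.map (Function.Embedding.subtype (· ∈ Z)) := by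
  refine Ultrafilter.of_le _ ((eventually_ge_atTop {⟨a, ha⟩}).mono fun t ht => ?_)
  exact Finset.mem_map.2 ⟨⟨a, ha⟩, Finset.singleton_subset_iff.1 ht, rfl⟩

theorem coe_map_subtype_subset {Z : Set 𝔻} (t : Finset Z) :
    ((t.map (Function.Embedding.subtype (· ∈ Z)) : Finset 𝔻) : Set 𝔻) ⊆ Z := fun a ha => by
  obtain ⟨b, -, rfl⟩ := Finset.mem_map.1 (Finset.mem_coe.1 ha)
  exact b.2

/-- Carleson's interpolation theorem. -/
theorem IsInterpolating.exists_interp {δ : ℝ} (hδ : 0 < δ) {Z : Set 𝔻} (hZ : IsInterpolating δ Z)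
    (c : 𝔻 → ℂ) {C : ℝ} (hC : 0 ≤ C) (hc : ∀ a ∈ Z, ‖c a‖ ≤ C) :
    ∃ g : Hinf, ‖g‖ ≤ interpConst δ * C ∧ ∀ a ∈ Z, g.1 a = c a := by
  choose g hg hgc using fun t : Finset Z =>
    (hZ _ (coe_map_subtype_subset t)).exists_interp hδ c hC
      fun a ha => hc a (coe_map_subtype_subset t ha)
  obtain ⟨G, hG, hlim⟩ := exists_tendsto_of_norm_le (Ultrafilter.of atTop) hg
  exact ⟨G, hG, fun a ha => tendsto_nhds_unique (hlim a) (tendsto_const_nhds.congr'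
    ((eventually_mem_of_atTop ha).mono fun t ht => (hgc t a ht).symm))⟩

/-- `B` is a Blaschke product of `Z`: a contractive function that vanishes on `Z` and divides,
without loss of norm, every function that vanishes on `Z`. -/
structure IsBlaschke (Z : Set 𝔻) (B : Hinf) : Prop where
  norm_le : ‖B‖ ≤ 1
  val_eq_zero : ∀ a ∈ Z, B.1 a = 0
  exists_eq_mul : ∀ G : Hinf, (∀ a ∈ Z, G.1 a = 0) → ∃ k : Hinf, ‖k‖ ≤ ‖G‖ ∧ G = B * k

theorem exists_isBlaschke (Z : Set 𝔻) : ∃ B : Hinf, IsBlaschke Z B := by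
  let e := Function.Embedding.subtype (· ∈ Z)
  obtain ⟨B, hB, hlim⟩ := exists_tendsto_of_norm_le (Ultrafilter.of (atTop : Filter (Finset Z)))
    (f := fun t => ∏ a ∈ t.map e, blaschke a) fun t => norm_prod_blaschke_le _
  refine ⟨B, hB, fun a ha => tendsto_nhds_unique (hlim a) (tendsto_const_nhds.congr'
    ((eventually_mem_of_atTop ha).mono fun t ht => ?_)), fun G hG => ?_⟩
  · refine Eq.symm ((prod_val _ _ _).trans ?_)
    exact (Finset.prod_eq_zero ht (blaschke_val_eq_zero.2 rfl))
  · choose k hk hGk using fun t : Finset Z => exists_eq_prod_blaschke_mul (t.map e) G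
      fun a ha => hG a (coe_map_subtype_subset t ha)
    obtain ⟨K, hK, hlimK⟩ := exists_tendsto_of_norm_le
      (Ultrafilter.of (atTop : Filter (Finset Z))) hk
    refine ⟨K, hK, hinf_ext fun z => tendsto_nhds_unique tendsto_const_nhds
      (((hlim z).mul (hlimK z)).congr fun t => ?_)⟩
    rw [← mul_val, ← hGk]

/-- The Blaschke product of an interpolating set is bounded away from zero off pseudohyperbolic
neighbourhoods of the set. -/
theorem IsBlaschke.one_le_norm_val_mul {δ η : ℝ} (hδ : 0 < δ) (hη : 0 < η) {Z : Set 𝔻}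
    (hZ : IsInterpolating δ Z) {B : Hinf} (hB : IsBlaschke Z B) {w : 𝔻}
    (hw : ∀ a ∈ Z, η ≤ rho w a) : 1 ≤ ‖B.1 w‖ * (1 + interpConst δ * η⁻¹) := by
  -- `G = 1 - b h`, with `b` the Blaschke factor of `w` and `h = 1 / b` on `Z`, vanishes on `Z` and
  -- equals `1` at `w`.
  obtain ⟨h, hh, hhZ⟩ := hZ.exists_interp hδ (fun a => ((blaschke w).1 a)⁻¹) (inv_nonneg.2 hη.le)
    fun a ha => by
      rw [norm_inv, norm_blaschke_val, rho_comm]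
      exact inv_anti₀ hη (hw a ha)
  obtain ⟨k, hk, hGk⟩ := hB.exists_eq_mul (1 - blaschke w * h) fun a ha => by
    have : (blaschke w).1 a ≠ 0 := norm_pos_iff.1 (by
      rw [norm_blaschke_val, rho_comm]; exact hη.trans_le (hw a ha))
    rw [sub_val, one_val, mul_val, hhZ a ha, mul_inv_cancel₀ this, sub_self]
  have h1 : (1 - blaschke w * h).1 w = 1 := by
    rw [sub_val, one_val, mul_val, blaschke_val_eq_zero.2 rfl, zero_mul, sub_zero]
  have h2 : ‖(1 - blaschke w * h : Hinf)‖ ≤ 1 + interpConst δ * η⁻¹ := by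
    refine norm_le_of_forall (by have := interpConst_pos hδ; positivity) fun z => ?_
    rw [sub_val, one_val, mul_val]
    refine (norm_sub_le _ _).trans ?_
    rw [norm_one, norm_mul, norm_blaschke_val]
    have h3 := mul_le_mul (rho_lt_one z w).le ((norm_val_le h z).trans hh) (norm_nonneg _)
      zero_le_one
    linarith
  rw [hGk, mul_val] at h1
  calc (1 : ℝ) = ‖B.1 w‖ * ‖k.1 w‖ := by rw [← norm_mul, h1, norm_one]
    _ ≤ _ := by
      gcongr
      exact (norm_val_le k w).trans (hk.trans h2)

theorem IsBlaschke.apply_eq_zero {Z : Set 𝔻} {B : Hinf} (hB : IsBlaschke Z B) {V : Filter 𝔻}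
    [V.NeBot] {m : MaxIdeal} (hV : V ≤ toward m) (hVZ : Z ∈ V) : m B = 0 :=
  tendsto_nhds_unique ((tendsto_val_toward m B).mono_left hV) (tendsto_const_nhds.congr'
    (eventually_of_mem hVZ fun a ha => (hB.val_eq_zero a ha).symm))

/-- If `m` is a limit of points of an interpolating set `Z`, then the points of the disc near `m`
are close to `Z` in the pseudohyperbolic distance. -/
theorem IsInterpolating.eventually_exists_rho_lt {δ η : ℝ} (hδ : 0 < δ) (hη : 0 < η) {Z : Set 𝔻}
    (hZ : IsInterpolating δ Z) {V : Filter 𝔻} [V.NeBot] {m : MaxIdeal} (hV : V ≤ toward m)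
    (hVZ : Z ∈ V) : ∀ᶠ w in toward m, ∃ a ∈ Z, rho w a < η := by
  obtain ⟨B, hB⟩ := exists_isBlaschke Z
  have hK : 0 < 1 + interpConst δ * η⁻¹ := by have := interpConst_pos hδ; positivity
  have h1 := (tendsto_val_toward m B).norm
  rw [hB.apply_eq_zero hV hVZ, norm_zero] at h1
  filter_upwards [h1.eventually (gt_mem_nhds (inv_pos.2 hK))] with w hw
  by_contra! hcon
  have h2 := hB.one_le_norm_val_mul hδ hη hZ hcon
  have h3 : ‖B.1 w‖ * (1 + interpConst δ * η⁻¹) < 1 := by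
    calc _ < (1 + interpConst δ * η⁻¹)⁻¹ * (1 + interpConst δ * η⁻¹) := by gcongr
      _ = 1 := inv_mul_cancel₀ hK.ne'
  linarith

/-- If `m` is a limit of points of an interpolating set, then `f (L_w z)` is Cauchy as `w` tends
to `m`: it is close to the value at `w` of the function that takes the values `f (L_a z)` at the
points `a` of the interpolating set. -/
theorem IsInterpolating.exists_eventually_norm_sub_le {δ : ℝ} (hδ : 0 < δ) {Z : Set 𝔻}
    (hZ : IsInterpolating δ Z) {V : Filter 𝔻} [V.NeBot] {m : MaxIdeal} (hV : V ≤ toward m)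
    (hVZ : Z ∈ V) (f : Hinf) (z : 𝔻) {ε : ℝ} (hε : 0 < ε) :
    ∃ c : ℂ, ∀ᶠ w in toward m, ‖f.1 (mobius w z) - c‖ ≤ ε := by
  obtain ⟨g, hg, hgZ⟩ := hZ.exists_interp hδ (fun a => f.1 (mobius a z)) (norm_nonneg f)
    fun a _ => norm_val_le f _
  have hz : 0 < 1 - ‖(z : ℂ)‖ := sub_pos.2 z.norm_lt_one
  set K := 2 * ‖f‖ * (12 / (1 - ‖(z : ℂ)‖)) + 2 * ‖g‖ with hK
  have hK0 : 0 ≤ K := by positivity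
  have hη : 0 < min (1 / 2) (ε / (2 * (K + 1))) := lt_min one_half_pos (by positivity)
  refine ⟨m g, ?_⟩
  filter_upwards [hZ.eventually_exists_rho_lt hδ hη hV hVZ,
    Metric.tendsto_nhds.1 (tendsto_val_toward m g) (ε / 2) (by positivity)] with w hw hwg
  obtain ⟨a, ha, hwa⟩ := hw
  have h1 := norm_sub_le_rho f (mobius w z) (mobius a z)
  have h2 := rho_mobius_mobius_le w a z (by rw [rho_comm]; exact hwa.le.trans (min_le_left _ _))
  have h3 := norm_sub_le_rho g a w
  rw [hgZ a ha] at h3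
  rw [rho_comm a w] at h2 h3
  rw [dist_eq_norm] at hwg
  have h4 : ‖f.1 (mobius w z) - f.1 (mobius a z)‖ ≤
      2 * ‖f‖ * (12 / (1 - ‖(z : ℂ)‖) * rho w a) := h1.trans (by gcongr)
  have h5 : K * rho w a ≤ ε / 2 := by
    calc K * rho w a ≤ (K + 1) * (ε / (2 * (K + 1))) := by
          have := rho_nonneg w a
          gcongr
          · linarith
          · exact hwa.le.trans (min_le_right _ _)
      _ = ε / 2 := by field_simp
  have h6 : f.1 (mobius w z) - m g = (f.1 (mobius w z) - f.1 (mobius a z)) +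
      (f.1 (mobius a z) - g.1 w) + (g.1 w - m g) := by ring
  rw [h6]
  refine norm_add₃_le.trans ?_
  rw [hK] at h5
  linarith

/-! ### Zeros with large derivative form interpolating sets -/

/-- The zeros `z` of `f` at which the quotient of `f` by the Blaschke factor of `z`, that is, the
derivative `(1 - |z| ^ 2) f' z`, has modulus at least `c`. -/
def simpleZeros (f : Hinf) (c : ℝ) : Set 𝔻 :=
  {z | ∃ k : Hinf, ‖k‖ ≤ ‖f‖ ∧ f = blaschke z * k ∧ c ≤ ‖k.1 z‖}

/-- Dividing `f` by the Blaschke product of finitely many simple zeros bounds each product of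
distances from below. -/
theorem isInterpolating_simpleZeros {f : Hinf} {c C : ℝ} (hfC : ‖f‖ ≤ C)
    (hC : 0 < C) : IsInterpolating (c / C) (simpleZeros f c) := by
  classical
  intro S hS a ha
  obtain ⟨k, hk, hfk, hka⟩ := hS ha
  obtain ⟨l, hl, hkl⟩ := exists_eq_prod_blaschke_mul (S.erase a) k fun b hb => by
    obtain ⟨k', -, hfk', -⟩ := hS (Finset.mem_of_mem_erase hb)
    have h1 : f.1 b = 0 := by rw [hfk', mul_val, blaschke_val_eq_zero.2 rfl, zero_mul]
    rw [hfk, mul_val, mul_eq_zero, blaschke_val_eq_zero] at h1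
    exact h1.resolve_left (Finset.ne_of_mem_erase hb)
  rw [hkl, mul_val, norm_mul, norm_prod_blaschke_val] at hka
  have h2 : ‖l.1 a‖ ≤ C := (norm_val_le l a).trans (hl.trans (hk.trans hfC))
  rw [div_le_iff₀ hC]
  refine hka.trans ?_
  have := Finset.prod_nonneg fun b (_ : b ∈ S.erase a) => rho_nonneg a b
  convert mul_le_mul_of_nonneg_left h2 this

/-- A zero of `f - α` at which `f ∘ L_w` has a large derivative is a simple zero in the sense of
`simpleZeros`. -/
theorem mobius_mem_simpleZeros {f : Hinf} {w ξ : 𝔻} {G : ℂ → ℂ}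
    (hGf : ∀ u : 𝔻, G u = (comp w f).1 u)
    (hξ : G ξ = 0) {c : ℝ} (hc : c ≤ ‖deriv G ξ‖) :
    mobius w ξ ∈ simpleZeros f (c * (1 - ‖(ξ : ℂ)‖)) := by
  have hξ1 : 0 < 1 - ‖(ξ : ℂ)‖ := sub_pos.2 ξ.norm_lt_one
  have hfz : f.1 (mobius w ξ) = 0 := by rw [← comp_val, ← hGf, hξ]
  obtain ⟨k, hk, hfk⟩ := exists_eq_blaschke_mul f _ hfz
  refine ⟨k, hk, hfk, ?_⟩
  obtain ⟨b, hb, hbv⟩ := (comp w (blaschke (mobius w ξ))).2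
  obtain ⟨K, hK, hKv⟩ := (comp w k).2
  have hmem : (ξ : ℂ) ∈ Metric.ball (0 : ℂ) 1 := mem_ball_zero_iff.2 ξ.norm_lt_one
  have hnhds : Metric.ball (0 : ℂ) 1 ∈ 𝓝 (ξ : ℂ) := Metric.isOpen_ball.mem_nhds hmem
  have hGb : G =ᶠ[𝓝 (ξ : ℂ)] fun u => b u * K u := eventually_of_mem hnhds fun u hu => by
    lift u to 𝔻 using mem_ball_zero_iff.1 hu
    refine (hGf u).trans (Eq.trans ?_ (congrArg₂ (· * ·) (hbv u) (hKv u)).symm)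
    rw [comp_val, comp_val, comp_val, ← mul_val, ← hfk]
  have hb0 : b ξ = 0 := by
    rw [hbv]
    exact (comp_val _ _ _).trans (blaschke_val_eq_zero.2 rfl)
  have hb1 : ‖deriv b ξ‖ ≤ 1 / (1 - ‖(ξ : ℂ)‖) := by
    have hsub : Metric.ball (ξ : ℂ) (1 - ‖(ξ : ℂ)‖) ⊆ Metric.ball 0 1 :=
      Metric.ball_subset_ball' (by rw [dist_zero_right]; linarith)
    refine Complex.norm_deriv_le_div_of_mapsTo_ball (hb.mono hsub) (fun u hu => ?_) hξ1
    have hu := hsub hu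
    lift u to 𝔻 using mem_ball_zero_iff.1 hu
    rw [hb0, mem_closedBall_zero_iff, hbv]
    change ‖(comp w _).1 u‖ ≤ 1
    rw [comp_val, norm_blaschke_val]
    exact (rho_lt_one _ _).le
  have hd : deriv G ξ = deriv b ξ * K ξ := by
    rw [hGb.deriv_eq, deriv_fun_mul (hb.differentiableAt hnhds) (hK.differentiableAt hnhds), hb0,
      zero_mul, add_zero]
  have hKξ : K ξ = k.1 (mobius w ξ) := by
    rw [hKv]; exact comp_val _ _ _
  rw [hd, norm_mul, hKξ] at hc
  calc c * (1 - ‖(ξ : ℂ)‖) ≤ (1 / (1 - ‖(ξ : ℂ)‖) * ‖k.1 (mobius w ξ)‖) * (1 - ‖(ξ : ℂ)‖) := by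
        gcongr
        exact hc.trans (by gcongr)
    _ = ‖k.1 (mobius w ξ)‖ := by field_simp

/-- A quantitative Hurwitz theorem: if `f ∘ L_w` tends to a nonconstant function along `U`, then
for suitable `α`, the function `f - α` has a simple zero at bounded pseudohyperbolic distance
from `w`, for most `w`. -/
theorem exists_eventually_mobius_mem_simpleZeros {U : Filter 𝔻} [U.NeBot] {f φ : Hinf}
    (hφ : ∀ z, Tendsto (fun w => f.1 (mobius w z)) U (𝓝 (φ.1 z))) {z₀ : 𝔻}
    (hz₀ : φ.1 z₀ ≠ φ.1 0) :
    ∃ (α : ℂ) (c r : ℝ), 0 < c ∧ r < 1 ∧ ∀ᶠ w in U, ∃ ξ : 𝔻, ‖(ξ : ℂ)‖ ≤ r ∧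
      mobius w ξ ∈ simpleZeros (f - algebraMap ℂ Hinf α) c := by
  obtain ⟨Φ, hΦ, hΦv⟩ := φ.2
  choose G hG hGv using fun w => (comp w f).2
  have hconv : TendstoLocallyUniformlyOn G Φ U (Metric.ball 0 1) :=
    tendstoLocallyUniformlyOn_of_tendsto (fun w => norm_comp_le w f) hGv fun z => by
      simp only [comp_val, hΦv]
      exact hφ z
  obtain ⟨a, ha, hda⟩ : ∃ a ∈ Metric.ball (0 : ℂ) 1, deriv Φ a ≠ 0 := by
    by_contra! hcon
    have h1 := Metric.isOpen_ball.is_const_of_deriv_eq_zero (convex_ball (0 : ℂ) 1).isPreconnected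
      hΦ hcon (mem_ball_zero_iff.2 z₀.norm_lt_one) (Metric.mem_ball_self one_pos)
    rw [hΦv] at h1
    have h2 := hΦv 0
    rw [Complex.UnitDisc.coe_zero] at h2
    exact hz₀ (h1.trans h2)
  have hnh : Metric.ball (0 : ℂ) 1 ∈ 𝓝 a := Metric.isOpen_ball.mem_nhds ha
  have hdc : ContinuousOn (deriv Φ) (Metric.ball 0 1) := (hΦ.deriv Metric.isOpen_ball).continuousOn
  have hc0 : 0 < ‖deriv Φ a‖ / 2 := by positivity
  have h1 : ∀ᶠ u in 𝓝 a, ‖deriv Φ a‖ / 2 < ‖deriv Φ u‖ :=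
    (hdc.continuousAt hnh).norm.eventually (lt_mem_nhds (by linarith))
  have h2 : ∀ᶠ u in 𝓝 a, u ≠ a → Φ u ≠ Φ a := by
    have := (hΦ.differentiableAt hnh).hasDerivAt.eventually_ne (c := Φ a) hda
    rwa [eventually_nhdsWithin_iff] at this
  obtain ⟨r₀, hr₀, hball⟩ := Metric.nhds_basis_closedBall.eventually_iff.1
    ((h1.and h2).and (eventually_mem_set.2 hnh))
  have hsub : Metric.closedBall a r₀ ⊆ Metric.ball 0 1 := fun u hu => (hball hu).2
  have hK : IsCompact (Metric.closedBall a r₀) := isCompact_closedBall a r₀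
  obtain ⟨ε, hε, hεs⟩ : ∃ ε > 0, ∀ u ∈ Metric.sphere a r₀, ε ≤ ‖Φ u - Φ a‖ := by
    have hne : (Metric.sphere a r₀).Nonempty := NormedSpace.sphere_nonempty.2 hr₀.le
    obtain ⟨u, hu, hmin⟩ := (isCompact_sphere a r₀).exists_isMinOn hne
      (f := fun u => ‖Φ u - Φ a‖) (((hΦ.continuousOn.mono
        (Metric.sphere_subset_closedBall.trans hsub)).sub continuousOn_const).norm)
    refine ⟨_, ?_, fun v hv => hmin hv⟩
    exact norm_pos_iff.2 (sub_ne_zero.2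
      ((hball (Metric.sphere_subset_closedBall hu)).1.2 (Metric.ne_of_mem_sphere hu hr₀.ne')))
  obtain ⟨u₁, hu₁, hmax⟩ := hK.exists_isMaxOn ⟨a, Metric.mem_closedBall_self hr₀.le⟩
    continuous_norm.continuousOn
  set r := ‖u₁‖ with hr
  have hr1 : r < 1 := mem_ball_zero_iff.1 (hsub hu₁)
  have hu1 := (tendstoLocallyUniformlyOn_iff_forall_isCompact Metric.isOpen_ball).1 hconv _ hsub hK
  have hu2 := (tendstoLocallyUniformlyOn_iff_forall_isCompact Metric.isOpen_ball).1
    (hconv.deriv (Eventually.of_forall hG) Metric.isOpen_ball) _ hsub hK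
  refine ⟨Φ a, ‖deriv Φ a‖ / 4 * (1 - r), r, mul_pos (by linarith) (by linarith), hr1, ?_⟩
  filter_upwards [Metric.tendstoUniformlyOn_iff.1 hu1 (ε / 4) (by positivity),
    Metric.tendstoUniformlyOn_iff.1 hu2 (‖deriv Φ a‖ / 4) (by positivity)] with w hw1 hw2
  have haK : a ∈ Metric.closedBall a r₀ := Metric.mem_closedBall_self hr₀.le
  have hder : ∀ u ∈ Metric.closedBall a r₀, ‖deriv Φ a‖ / 4 ≤ ‖deriv (G w) u‖ := fun u hu => by
    have h3 := hw2 u hu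
    rw [dist_eq_norm] at h3
    have h4 := (hball hu).1.1
    have h5 := norm_sub_norm_le (deriv Φ u) (deriv (G w) u)
    change ‖deriv Φ u - deriv (G w) u‖ < _ at h3
    linarith
  have himg : Metric.ball (G w a) (ε / 2 / 2) ⊆ G w '' Metric.closedBall a r₀ := by
    refine DiffContOnCl.ball_subset_image_closedBall
      ((hG w).diffContOnCl_ball hsub) hr₀ (fun u hu => ?_) ?_
    · have h3 := hw1 u (Metric.sphere_subset_closedBall hu)
      have h4 := hw1 a haK
      rw [dist_eq_norm] at h3 h4
      have h5 : Φ u - Φ a = (Φ u - G w u) - (Φ a - G w a) + (G w u - G w a) := by ring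
      have h6 := hεs u hu
      rw [h5] at h6
      have h7 := norm_add_le ((Φ u - G w u) - (Φ a - G w a)) (G w u - G w a)
      have h8 := norm_sub_le (Φ u - G w u) (Φ a - G w a)
      linarith
    · have h3 : deriv (G w) a ≠ 0 := norm_pos_iff.1 (lt_of_lt_of_le (by linarith) (hder a haK))
      exact (((hG w).differentiableAt hnh).hasDerivAt.eventually_ne (c := G w a) h3).frequently
        |>.filter_mono nhdsWithin_le_nhds
  obtain ⟨ξ, hξ, hξa⟩ := himg (show Φ a ∈ _ by
    rw [Metric.mem_ball]
    exact (hw1 a haK).trans_eq (by ring))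
  have hξ1 := hder ξ hξ
  have hξr : ‖ξ‖ ≤ r := hmax hξ
  lift ξ to 𝔻 using mem_ball_zero_iff.1 (hsub hξ)
  refine ⟨ξ, hξr, ?_⟩
  have h3 := mobius_mem_simpleZeros (f := f - algebraMap ℂ Hinf (Φ a)) (w := w) (ξ := ξ)
    (G := fun u => G w u - Φ a) (fun u => by
      rw [comp_val, sub_val, algebraMap_val, ← comp_val, hGv]) (by rw [hξa, sub_self])
    (c := ‖deriv Φ a‖ / 4) (by rwa [deriv_sub_const_fun])
  obtain ⟨k, hk, hfk, hkc⟩ := h3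
  refine ⟨k, hk, hfk, le_trans ?_ hkc⟩
  gcongr

/-! ### Thinning out and moving interpolating sets -/

/-- Given a graph of degree at most `N` on a set `Z`, an ultrafilter that contains `Z` contains an
independent subset of `Z`. -/
theorem exists_independent_mem {X : Type*} (V : Ultrafilter X) (R : X → X → Prop)
    (hR : ∀ a b, R a b → R b a) (N : ℕ) (Z : Set X) (hZV : Z ∈ V)
    (hN : ∀ a ∈ Z, ∀ S : Finset X, ↑S ⊆ Z → (∀ b ∈ S, b ≠ a ∧ R a b) → S.card ≤ N) :
    ∃ Y ⊆ Z, Y ∈ V ∧ Y.Pairwise fun a b => ¬R a b := by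
  classical
  -- A maximal independent set either belongs to `V`, or is removed to lower the degree.
  induction N generalizing Z with
  | zero =>
    refine ⟨Z, subset_rfl, hZV, fun a ha b hb hab h => ?_⟩
    have := hN a ha {b} (by simpa using hb) (by simpa using ⟨hab.symm, h⟩)
    simp at this
  | succ N ih =>
    obtain ⟨Y, hY⟩ := zorn_subset {Y : Set X | Y ⊆ Z ∧ Y.Pairwise fun a b => ¬R a b}
      fun c hc hchain => ⟨⋃₀ c, ⟨Set.sUnion_subset fun s hs => (hc hs).1,
        (Set.pairwise_sUnion hchain.directedOn).2 fun s hs => (hc hs).2⟩,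
        fun s hs => Set.subset_sUnion_of_mem hs⟩
    by_cases hYV : Y ∈ V
    · exact ⟨Y, hY.prop.1, hYV, hY.prop.2⟩
    obtain ⟨Y', hY', hY'V, hY'p⟩ := ih (Z \ Y)
      (inter_mem hZV (Ultrafilter.compl_mem_iff_notMem.2 hYV)) fun a ha S hS hSa => by
        obtain ⟨b, hb, hab⟩ : ∃ b ∈ Y, R a b := by
          by_contra! hcon
          refine ha.2 (hY.le_of_ge ⟨Set.insert_subset ha.1 hY.prop.1, ?_⟩
            (Set.subset_insert a Y) (Set.mem_insert a Y))
          exact hY.prop.2.insert fun b hb _ => ⟨hcon b hb, fun h => hcon b hb (hR _ _ h)⟩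
        have hbS : b ∉ S := fun h => (hS h).2 hb
        have := hN a ha.1 (insert b S) (by
          rw [Finset.coe_insert]
          exact Set.insert_subset (hY.prop.1 hb) (hS.trans Set.sdiff_subset)) fun d hd => by
            rcases Finset.mem_insert.1 hd with rfl | hd
            · exact ⟨fun h => ha.2 (h ▸ hb), hab⟩
            · exact hSa d hd
        rw [Finset.card_insert_of_notMem hbS] at this
        omega
    exact ⟨Y', hY'.trans Set.sdiff_subset, hY'V, hY'p⟩

/-- An ultrafilter on an interpolating set contains a subset whose points are far apart. -/
theorem IsInterpolating.exists_sparse {δ τ : ℝ} (hδ : 0 < δ) (hτ : 0 < τ) {Z : Set 𝔻}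
    (hZ : IsInterpolating δ Z) {V : Ultrafilter 𝔻} (hV : Z ∈ V) :
    ∃ Y ⊆ Z, Y ∈ V ∧ Y.Pairwise fun a b => 1 - rho a b ^ 2 ≤ τ := by
  classical
  obtain ⟨Y, hYZ, hYV, hY⟩ := exists_independent_mem V (fun a b => τ < 1 - rho a b ^ 2)
    (fun a b h => by rwa [rho_comm]) ⌈-2 * Real.log δ / τ⌉₊ Z hV fun a ha S hS hSa => by
      have h1 := (hZ (insert a S) (by
        rw [Finset.coe_insert]
        exact Set.insert_subset ha hS)).sum_le hδ (Finset.mem_insert_self a S)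
      rw [Finset.erase_insert fun h => (hSa a h).1 rfl] at h1
      have h2 := Finset.card_nsmul_le_sum S (fun b => 1 - rho a b ^ 2) τ
        fun b hb => (hSa b hb).2.le
      rw [nsmul_eq_mul] at h2
      have h3 : (S.card : ℝ) ≤ -2 * Real.log δ / τ := by
        rw [le_div_iff₀ hτ]
        linarith
      exact_mod_cast h3.trans (Nat.le_ceil _)
  exact ⟨Y, hYZ, hYV, fun a ha b hb hab => not_lt.1 (hY ha hb hab)⟩

theorem exp_neg_le_of_one_sub_sq_le {x y : ℝ} (hx : 0 ≤ x) (hy : 1 - x ^ 2 ≤ y)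
    (hy0 : 0 ≤ y) (hy1 : y ≤ 1 / 2) : Real.exp (-y) ≤ x := by
  have h1 : Real.exp (-y) ^ 2 * Real.exp (2 * y) = 1 := by
    rw [← Real.exp_nat_mul, ← Real.exp_add]; simp
  have h2 := Real.add_one_le_exp (2 * y)
  have h3 := sq_nonneg (Real.exp (-y))
  refine (sq_le_sq₀ (Real.exp_pos _).le hx).1 ?_
  have h4 : Real.exp (-y) ^ 2 * (2 * y + 1) ≤ 1 :=
    (mul_le_mul_of_nonneg_left h2 h3).trans_eq h1
  have h5 : 1 ≤ (1 - y) * (2 * y + 1) := by nlinarith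
  have h6 : Real.exp (-y) ^ 2 ≤ 1 - y := by
    by_contra! hcon
    nlinarith
  linarith

/-- A sparse interpolating set remains interpolating when each of its points `a` is replaced
by `L_a p`. -/
theorem IsInterpolating.image_mobius {δ : ℝ} (hδ : 0 < δ) {Y : Set 𝔻} (hY : IsInterpolating δ Y)
    (p : 𝔻) {H : ℝ} (hH : H = (1 + ‖(p : ℂ)‖) / (1 - ‖(p : ℂ)‖))
    (hsep : Y.Pairwise fun a b => 1 - rho a b ^ 2 ≤ 1 / (2 * H ^ 2)) :
    IsInterpolating (Real.exp (2 * H ^ 2 * Real.log δ)) ((fun a => mobius a p) '' Y) := by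
  classical
  have hp := p.norm_lt_one
  have hH0 : 0 < H := by
    rw [hH]
    exact div_pos (by positivity) (by linarith)
  have hpa : ∀ a, rho (mobius a p) a ≤ ‖(p : ℂ)‖ := fun a => by
    have := rho_mobius a p 0
    rw [mobius_zero, rho_zero] at this
    exact this.le
  have hcomp : ∀ a b, 1 - rho (mobius a p) (mobius b p) ^ 2 ≤ H ^ 2 * (1 - rho a b ^ 2) := by
    intro a b
    have h1 := one_sub_rho_sq_le hp (hpa a) (mobius b p)
    have h2 := one_sub_rho_sq_le hp (hpa b) a
    rw [← hH] at h1 h2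
    rw [rho_comm _ a, rho_comm b a] at h2
    calc _ ≤ H * (1 - rho a (mobius b p) ^ 2) := h1
      _ ≤ H * (H * (1 - rho a b ^ 2)) := by gcongr
      _ = _ := by ring
  intro S hS a' ha'
  choose! σ hσY hσ using fun b (hb : b ∈ S) => hS hb
  have hinj : Set.InjOn σ S := fun b hb b' hb' h => by
    have h1 := hσ b hb
    have h2 := hσ b' hb'
    rw [h] at h1
    exact h1.symm.trans h2
  have hne : ∀ b ∈ S.erase a', σ a' ≠ σ b := fun b hb h =>
    Finset.ne_of_mem_erase hb (hinj ha' (Finset.mem_of_mem_erase hb) h).symm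
  have hsum : ∑ b ∈ S.erase a', (1 - rho (σ a') (σ b) ^ 2) ≤ -2 * Real.log δ := by
    have h1 := (hY (S.image σ) (by
      rw [Finset.coe_image]
      rintro _ ⟨b, hb, rfl⟩
      exact hσY b hb)).sum_le hδ (Finset.mem_image_of_mem σ ha')
    refine le_trans (le_of_eq ?_) h1
    have h2 : (S.image σ).erase (σ a') = (S.erase a').image σ := by
      ext d
      simp only [Finset.mem_erase, Finset.mem_image]
      constructor
      · rintro ⟨hd, b, hb, rfl⟩
        exact ⟨b, ⟨fun h => hd (h ▸ rfl), hb⟩, rfl⟩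
      · rintro ⟨b, hb, rfl⟩
        exact ⟨(hne b (Finset.mem_erase.2 hb)).symm, b, hb.2, rfl⟩
    rw [h2, Finset.sum_image fun b hb b' hb' h =>
      hinj (Finset.mem_of_mem_erase hb) (Finset.mem_of_mem_erase hb') h]
  calc Real.exp (2 * H ^ 2 * Real.log δ)
      ≤ Real.exp (∑ b ∈ S.erase a', -(H ^ 2 * (1 - rho (σ a') (σ b) ^ 2))) := by
        rw [Finset.sum_neg_distrib, ← Finset.mul_sum]
        refine Real.exp_le_exp.2 ?_
        nlinarith [sq_nonneg H]
    _ = ∏ b ∈ S.erase a', Real.exp (-(H ^ 2 * (1 - rho (σ a') (σ b) ^ 2))) := Real.exp_sum _ _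
    _ ≤ ∏ b ∈ S.erase a', rho a' b := by
        refine Finset.prod_le_prod (fun b _ => (Real.exp_pos _).le) fun b hb => ?_
        have hb' := Finset.mem_of_mem_erase hb
        have h1 := hcomp (σ a') (σ b)
        have h2 : mobius (σ a') p = a' := hσ a' ha'
        have h3 : mobius (σ b) p = b := hσ b hb'
        rw [h2, h3] at h1
        refine exp_neg_le_of_one_sub_sq_le (rho_nonneg _ _) h1
          (mul_nonneg (sq_nonneg H) (one_sub_rho_sq_pos _ _).le) ?_
        have h4 := mul_le_mul_of_nonneg_left (hsep (hσY a' ha') (hσY b hb') (hne b hb))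
          (sq_nonneg H)
        refine h4.trans_eq ?_
        field_simp
    _ = _ := by congr!

/-- If some `f ∘ L_w` has a nonconstant limit along an ultrafilter that tends to `m`, then `m` is
a limit of points of an interpolating set. -/
theorem exists_isInterpolating {m : MaxIdeal} {U : Ultrafilter 𝔻} (hU : ↑U ≤ toward m) {f : Hinf}
    {z : 𝔻} (hfz : ¬Tendsto (fun w => f.1 (mobius w z)) U (𝓝 (m f))) :
    ∃ δ > 0, ∃ (Z : Set 𝔻) (V : Ultrafilter 𝔻), IsInterpolating δ Z ∧ Z ∈ V ∧ ↑V ≤ toward m := by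
  obtain ⟨φ, -, hφ⟩ := exists_tendsto_of_norm_le U fun w => norm_comp_le w f
  simp only [comp_val] at hφ
  have hφ0 : φ.1 0 = m f := by
    have h1 := hφ 0
    simp only [mobius_zero] at h1
    exact tendsto_nhds_unique h1 ((tendsto_val_toward m f).mono_left hU)
  obtain ⟨α, c, r, hc, hr, hev⟩ := exists_eventually_mobius_mem_simpleZeros hφ (z₀ := z)
    fun h => hfz (by rw [← hφ0, ← h]; exact hφ z)
  obtain ⟨ξ, hξ⟩ := hev.choice
  set F := f - algebraMap ℂ Hinf α
  have hZ : IsInterpolating (c / (‖F‖ + 1)) (simpleZeros F c) :=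
    isInterpolating_simpleZeros (by linarith) (by positivity)
  have hδ : 0 < c / (‖F‖ + 1) := by positivity
  -- `ζ w` is the zero near `w`, and `w = L_{ζ w} (ξ' w)`.
  let ζ : 𝔻 → 𝔻 := fun w => mobius w (ξ w)
  let ξ' : 𝔻 → 𝔻 := fun w => mobius (-ζ w) w
  have hξ' : ∀ᶠ w in U, ‖(ξ' w : ℂ)‖ ≤ r := hξ.mono fun w hw => by
    have h1 : ‖(ξ' w : ℂ)‖ = ‖(ξ w : ℂ)‖ := by
      change rho w (mobius w (ξ w)) = _
      have := rho_mobius w 0 (ξ w)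
      rwa [mobius_zero, rho_comm 0, rho_zero] at this
    rw [h1]; exact hw.1
  obtain ⟨p, hp, hlim⟩ := (isCompact_closedBall (0 : ℂ) r).ultrafilter_le_nhds
    (U.map fun w => (ξ' w : ℂ)) (tendsto_principal.2 (hξ'.mono fun w hw =>
      mem_closedBall_zero_iff.2 hw))
  replace hlim : Tendsto (fun w => (ξ' w : ℂ)) U (𝓝 p) := hlim
  lift p to 𝔻 using (mem_closedBall_zero_iff.1 hp).trans_lt hr
  -- The interpolating set consists of the points `L_ζ p`, for `ζ` in a sparse set of zeros.
  set H := (1 + ‖(p : ℂ)‖) / (1 - ‖(p : ℂ)‖) with hH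
  have hp1 := p.norm_lt_one
  have hH0 : 0 < H := div_pos (by positivity) (by linarith)
  obtain ⟨Y, hYZ, hYV, hY⟩ := hZ.exists_sparse hδ (τ := 1 / (2 * H ^ 2)) (by positivity)
    (V := U.map ζ) (Ultrafilter.mem_map.2 (hξ.mono fun w hw => hw.2))
  have hYi : IsInterpolating (c / (‖F‖ + 1)) Y := fun S hS => hZ S (hS.trans hYZ)
  refine ⟨_, Real.exp_pos _, _, U.map fun w => mobius (ζ w) p, hYi.image_mobius hδ p hH hY, ?_, ?_⟩
  · exact Ultrafilter.mem_map.2 (mem_of_superset (Ultrafilter.mem_map.1 hYV)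
      fun w hw => ⟨ζ w, hw, rfl⟩)
  · refine tendsto_iff_comap.1 (?_ : Tendsto point (map (fun w => mobius (ζ w) p) U) (𝓝 m))
    refine tendsto_map'_iff.2 (tendsto_point_iff.2 fun g => ?_)
    refine ((tendsto_val_toward m g).mono_left hU).congr_dist ?_
    have hrho : Tendsto (fun w => 2 * ‖g‖ * (‖(ξ' w : ℂ) - p‖ / (1 - ‖(p : ℂ)‖))) U (𝓝 0) := by
      have := ((hlim.sub_const (p : ℂ)).norm.div_const (1 - ‖(p : ℂ)‖)).const_mul (2 * ‖g‖)
      rwa [sub_self, norm_zero, zero_div, mul_zero] at this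
    refine squeeze_zero (fun _ => dist_nonneg) (fun w => ?_) hrho
    have h2 : rho w (mobius (ζ w) p) = rho (ξ' w) p := by
      rw [← rho_mobius (ζ w) (ξ' w) p, mobius_mobius_neg]
    have h3 := norm_sub_le_rho g w (mobius (ζ w) p)
    rw [h2] at h3
    rw [dist_eq_norm]
    exact h3.trans (mul_le_mul_of_nonneg_left (rho_le_norm_sub_div _ _)
      (mul_nonneg zero_le_two (norm_nonneg g)))

/-! ### Existence of the limits -/

/-- The Cauchy property of `f (L_w z)` as `w` tends to an arbitrary `m`. If all ultrafilters that
tend to `m` give the limit `m f`, there is nothing to prove; otherwise `m` is a limit of points of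
an interpolating set. -/
theorem exists_eventually_norm_sub_le (m : MaxIdeal) (f : Hinf) (z : 𝔻) {ε : ℝ} (hε : 0 < ε) :
    ∃ c : ℂ, ∀ᶠ w in toward m, ‖f.1 (mobius w z) - c‖ ≤ ε := by
  by_cases h : ∃ (U : Ultrafilter 𝔻) (f : Hinf) (z : 𝔻), ↑U ≤ toward m ∧
      ¬Tendsto (fun w => f.1 (mobius w z)) U (𝓝 (m f))
  · obtain ⟨U, f', z', hU, hfz⟩ := h
    obtain ⟨δ, hδ, Z, V, hZ, hZV, hV⟩ := exists_isInterpolating hU hfz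
    exact hZ.exists_eventually_norm_sub_le hδ hV hZV f z hε
  · push Not at h
    refine ⟨m f, ?_⟩
    have h1 : Tendsto (fun w => f.1 (mobius w z)) (toward m) (𝓝 (m f)) :=
      (tendsto_iff_ultrafilter _ _ _).2 fun U hU => h U f z hU
    filter_upwards [Metric.tendsto_nhds.1 h1 ε hε] with w hw
    rw [← dist_eq_norm]
    exact hw.le

theorem tendsto_hoffman (m : MaxIdeal) (z : 𝔻) :
    Tendsto (fun w : 𝔻 => point (mobius w z)) (toward m) (𝓝 (hoffman m z)) := by
  rcases (toward m).eq_or_neBot with hbot | hm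
  · rw [hbot]; exact tendsto_bot
  rw [hoffman, if_pos hm]
  refine tendsto_nhds_limUnder ?_
  let U := Ultrafilter.of (toward m)
  have hU : ↑U ≤ toward m := Ultrafilter.of_le _
  obtain ⟨x, -, hx⟩ := isCompact_univ.ultrafilter_le_nhds (U.map fun w => point (mobius w z))
    (by simp)
  have hx' : Tendsto (fun w => point (mobius w z)) U (𝓝 x) := hx
  refine ⟨x, tendsto_point_iff.2 fun f => Metric.tendsto_nhds.2 fun ε hε => ?_⟩
  obtain ⟨c, hc⟩ := exists_eventually_norm_sub_le m f z (ε := ε / 3) (by positivity)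
  have h1 : ‖x f - c‖ ≤ ε / 3 :=
    le_of_tendsto ((tendsto_point_iff.1 hx' f).sub_const c).norm (hU hc)
  filter_upwards [hc] with w hw
  rw [dist_eq_norm]
  have h2 : f.1 (mobius w z) - x f = (f.1 (mobius w z) - c) - (x f - c) := by ring
  rw [h2]
  refine (norm_sub_le _ _).trans_lt ?_
  linarith

theorem tendsto_val_hoffman (m : MaxIdeal) (z : 𝔻) (f : Hinf) :
    Tendsto (fun w : 𝔻 => f.1 (mobius w z)) (toward m) (𝓝 (hoffman m z f)) :=
  tendsto_point_iff.1 (tendsto_hoffman m z) f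

theorem hoffman_of_not_neBot {m : MaxIdeal} (hm : ¬(toward m).NeBot) (z : 𝔻) :
    hoffman m z = m := if_neg hm

theorem isAnalyticMap_hoffman (m : MaxIdeal) : IsAnalyticMap (hoffman m) := fun f => by
  by_cases hm : (toward m).NeBot
  · obtain ⟨g, -, hg⟩ := exists_tendsto_of_norm_le (Ultrafilter.of (toward m))
      fun w => norm_comp_le w f
    refine ⟨g, fun z => tendsto_nhds_unique (hg z) ?_⟩
    simp only [comp_val]
    exact (tendsto_val_hoffman m z f).mono_left (Ultrafilter.of_le _)
  · exact ⟨algebraMap ℂ Hinf (m f), fun z => by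
      rw [hoffman_of_not_neBot hm]; exact algebraMap_val _ z⟩

theorem tendsto_coe_toward (m : MaxIdeal) :
    Tendsto (fun w : 𝔻 => (w : ℂ)) (toward m) (𝓝 (proj m : ℂ)) :=
  tendsto_val_toward m idHinf

/-- With `u = 1 + conj (π x) * w`, a number in the right half-plane, the quotient in the definition
of `λ` is `exp (2 i arg u)`. The harmonic function `arg u` is `-log |G|` for the invertible bounded
function `G = exp (i log u)`, so it extends continuously to the maximal ideal space. -/
theorem tendsto_budde (x y : MaxIdeal) :
    Tendsto (unimodularQuotient (proj x)) (toward y) (𝓝 (budde x y)) := by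
  refine tendsto_nhds_limUnder ?_
  set a : ℂ := (proj x : ℂ) with ha
  have ha1 : ‖a‖ ≤ 1 := (proj x).norm_le_one
  let u : ℂ → ℂ := fun w => 1 + conj a * w
  have hu : ∀ w ∈ Metric.ball (0 : ℂ) 1, u w ∈ Complex.slitPlane := fun w hw => by
    refine Or.inl ?_
    have h1 : ‖conj a * w‖ < 1 := by
      rw [norm_mul, Complex.norm_conj]
      have := mem_ball_zero_iff.1 hw
      nlinarith [norm_nonneg w, norm_nonneg a]
    have h2 := neg_abs_le (conj a * w).re
    have h3 := Complex.abs_re_le_norm (conj a * w)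
    simp only [u, Complex.add_re, Complex.one_re]
    linarith
  have hlog : DifferentiableOn ℂ (fun w => Complex.log (u w)) (Metric.ball 0 1) :=
    DifferentiableOn.clog (by fun_prop) hu
  have hnorm : ∀ w, ‖Complex.exp (Complex.I * Complex.log (u w))‖ =
      Real.exp (-Complex.arg (u w)) := fun w => by
    rw [Complex.norm_exp, Complex.I_mul_re, Complex.log_im]
  have hnorm' : ∀ w, ‖Complex.exp (-(Complex.I * Complex.log (u w)))‖ =
      Real.exp (Complex.arg (u w)) := fun w => by
    rw [Complex.norm_exp, Complex.neg_re, Complex.I_mul_re, Complex.log_im, neg_neg]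
  let G : Hinf := ofFun (fun w => Complex.exp (Complex.I * Complex.log (u w)))
    (hlog.const_mul _).cexp (Real.exp Real.pi) fun w => by
      rw [hnorm]
      exact Real.exp_le_exp.2 (neg_le.1 (Complex.neg_pi_lt_arg _).le)
  let G' : Hinf := ofFun (fun w => Complex.exp (-(Complex.I * Complex.log (u w))))
    (hlog.const_mul _).neg.cexp (Real.exp Real.pi) fun w => by
      rw [hnorm']
      exact Real.exp_le_exp.2 (Complex.arg_le_pi _)
  have hGG : G * G' = 1 := hinf_ext fun w => by
    refine (mul_val G G' w).trans ?_
    rw [ofFun_val, ofFun_val, ← Complex.exp_add, add_neg_cancel, Complex.exp_zero]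
    rfl
  have hy : y G ≠ 0 := fun h => by
    have h1 := congrArg y hGG
    rw [map_mul, h, zero_mul, map_one] at h1
    exact zero_ne_one h1
  refine ⟨Circle.exp (-2 * Real.log ‖y G‖), ?_⟩
  have hval : ∀ w : 𝔻, unimodularQuotient (proj x) w = Circle.exp (-2 * Real.log ‖G.1 w‖) := by
    intro w
    have h0 : u w ≠ 0 :=
      Complex.slitPlane_ne_zero (hu w (mem_ball_zero_iff.2 w.norm_lt_one))
    have h1 : Real.log ‖G.1 w‖ = -Complex.arg (u w) := by
      rw [ofFun_val, hnorm, Real.log_exp]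
    refine Circle.ext ?_
    rw [Circle.coe_exp, h1]
    have h2 : ((unimodularQuotient (proj x) w : Circle) : ℂ) = u w / conj (u w) := by
      change (1 + conj a * w) / (1 + a * conj (w : ℂ)) = _
      simp [u]
    have h3 : u w = ‖u w‖ * Complex.exp (Complex.arg (u w) * Complex.I) :=
      (Complex.norm_mul_exp_arg_mul_I _).symm
    have h4 : conj (u w) ≠ 0 := (map_ne_zero _).2 h0
    rw [h2, div_eq_iff h4]
    have h5 : conj (u w) = ‖u w‖ * Complex.exp (-(Complex.arg (u w) * Complex.I)) := by
      conv_lhs => rw [h3]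
      rw [map_mul, Complex.conj_ofReal, ← Complex.exp_conj, map_mul, Complex.conj_ofReal,
        Complex.conj_I, mul_neg]
    rw [h5, mul_left_comm, ← Complex.exp_add]
    conv_lhs => rw [h3]
    congr 2
    push_cast
    ring
  refine Tendsto.congr (fun w => (hval w).symm) ?_
  exact (Circle.exp.continuous.tendsto _).comp
    (((tendsto_val_toward y G).norm.log (norm_ne_zero_iff.2 hy)).const_mul _)

/-! ### The composition formula on the closure of the disc -/

/-- A bounded family in `H^∞` is equicontinuous, so a convergent rotation of the argument may be
replaced by its limit. -/
theorem tendsto_circle_smul {ι : Type*} {l : Filter ι} {h : ι → Hinf} {C : ℝ}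
    (hC : ∀ i, ‖h i‖ ≤ C) {q : ι → Circle} {q₀ : Circle} (hq : Tendsto q l (𝓝 q₀)) {z : 𝔻} {c : ℂ}
    (hc : Tendsto (fun i => (h i).1 (q₀ • z)) l (𝓝 c)) :
    Tendsto (fun i => (h i).1 (q i • z)) l (𝓝 c) := by
  refine hc.congr_dist ?_
  have hz : 0 < 1 - ‖((q₀ • z : 𝔻) : ℂ)‖ := sub_pos.2 (q₀ • z).norm_lt_one
  have h1 : Tendsto (fun i => 2 * C * (‖((q i : ℂ) - q₀) * z‖ / (1 - ‖((q₀ • z : 𝔻) : ℂ)‖))) l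
      (𝓝 0) := by
    have h2 : Tendsto (fun i => (q i : ℂ)) l (𝓝 (q₀ : ℂ)) :=
      ((by fun_prop : Continuous fun c : Circle => (c : ℂ)).tendsto _).comp hq
    have h3 := ((((h2.sub_const (q₀ : ℂ)).mul_const (z : ℂ)).norm.div_const
      (1 - ‖((q₀ • z : 𝔻) : ℂ)‖)).const_mul (2 * C))
    rwa [sub_self, zero_mul, norm_zero, zero_div, mul_zero] at h3
  refine squeeze_zero (fun _ => dist_nonneg) (fun i => ?_) h1
  have h4 := norm_sub_le_rho (h i) (q₀ • z) (q i • z)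
  rw [rho_comm] at h4
  have h5 := rho_le_norm_sub_div (q i • z) (q₀ • z)
  have h6 : ((q i • z : 𝔻) : ℂ) - (q₀ • z : 𝔻) = ((q i : ℂ) - q₀) * z := (sub_mul _ _ _).symm
  rw [h6] at h5
  rw [dist_eq_norm]
  refine h4.trans ?_
  have h7 := (norm_nonneg (h i)).trans (hC i)
  exact mul_le_mul (mul_le_mul_of_nonneg_left (hC i) zero_le_two) h5 (rho_nonneg _ _)
    (mul_nonneg zero_le_two h7)

theorem tendsto_unimodularQuotient (m : MaxIdeal) (v : 𝔻) :
    Tendsto (fun w : 𝔻 => unimodularQuotient (.mk w w.norm_lt_one.le) v) (toward m)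
      (𝓝 (unimodularQuotient (proj m) v)) := by
  refine tendsto_subtype_rng.2 ?_
  have h1 := tendsto_coe_toward m
  have h2 := (Complex.continuous_conj.tendsto _).comp h1
  exact ((h2.mul_const (v : ℂ)).const_add 1).div ((h1.mul_const (conj (v : ℂ))).const_add 1)
    (one_add_mul_ne_zero _ _ (proj m).norm_le_one (by
      rw [Complex.norm_conj]; exact v.norm_lt_one))

theorem tendsto_mobius_toward (m : MaxIdeal) (v : 𝔻) :
    Tendsto (fun w => mobius w v) (toward m) (toward (hoffman m v)) :=
  tendsto_comap_iff.2 (tendsto_hoffman m v)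

/-- The composition formula for `y = v` in the disc. -/
theorem hoffman_mobius {m : MaxIdeal} (hm : (toward m).NeBot) (v z : 𝔻) :
    hoffman m (mobius v (unimodularQuotient (proj m) v • z)) = hoffman (hoffman m v) z := by
  refine maxIdeal_ext fun f => ?_
  have h1 := (tendsto_val_hoffman (hoffman m v) z f).comp (tendsto_mobius_toward m v)
  refine tendsto_nhds_unique ?_ h1
  have h2 := tendsto_circle_smul (h := fun w => comp v (comp w f)) (C := ‖f‖)
    (fun w => (norm_comp_le _ _).trans (norm_comp_le _ _)) (tendsto_unimodularQuotient m v)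
    (z := z) (c := hoffman m (mobius v (unimodularQuotient (proj m) v • z)) f) (by
      simp only [comp_val]
      exact tendsto_val_hoffman m _ f)
  refine h2.congr fun w => ?_
  rw [comp_val, comp_val, mobius_mobius]
  rfl

/-- On the closure of the disc, `x ↦ L_x z` is continuous. -/
theorem tendsto_hoffman_of_tendsto {ι : Type*} {l : Filter ι} {X : ι → MaxIdeal} {x : MaxIdeal}
    (hX : ∀ i, (toward (X i)).NeBot) (hx : Tendsto X l (𝓝 x)) (z : 𝔻) :
    Tendsto (fun i => hoffman (X i) z) l (𝓝 (hoffman x z)) := by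
  refine tendsto_maxIdeal_iff.2 fun f => Metric.tendsto_nhds.2 fun ε hε => ?_
  have h1 := Metric.tendsto_nhds.1 (tendsto_val_hoffman x z f) (ε / 2) (by positivity)
  obtain ⟨O, hO, hOs⟩ := mem_comap.1 h1
  obtain ⟨O', hO'O, hO', hxO'⟩ := mem_nhds_iff.1 hO
  filter_upwards [hx (hO'.mem_nhds hxO')] with i hi
  have hev : ∀ᶠ w in toward (X i), dist (f.1 (mobius w z)) (hoffman x z f) ≤ ε / 2 :=
    ((tendsto_point_toward (X i)).eventually (hO'.mem_nhds hi)).mono fun w hw =>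
      (hOs (hO'O hw)).le
  have := hX i
  exact (le_of_tendsto ((tendsto_val_hoffman (X i) z f).dist tendsto_const_nhds) hev).trans_lt
    (by linarith)

/-- The composition formula for `m` and `y` in the closure of the disc, as a limit of
`hoffman_mobius`. -/
theorem extend_hoffman_hoffman {m y : MaxIdeal} (hm : (toward m).NeBot) (hy : (toward y).NeBot)
    (hL : IsAnalyticMap (hoffman m)) (z : 𝔻) :
    extend (hoffman m) hL (hoffman y (budde m y • z)) = hoffman (extend (hoffman m) hL y) z := by
  have hx : Tendsto (hoffman m) (toward y) (𝓝 (extend (hoffman m) hL y)) :=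
    tendsto_maxIdeal_iff.2 fun f => by
      simp only [← pullback_apply (hoffman m) hL, extend_apply]
      exact tendsto_val_toward y _
  have hX : ∀ v, (toward (hoffman m v)).NeBot := fun v => (tendsto_mobius_toward m v).neBot
  refine maxIdeal_ext fun f => ?_
  refine tendsto_nhds_unique (f := fun v => hoffman (hoffman m v) z f) ?_
    (tendsto_maxIdeal_iff.1 (tendsto_hoffman_of_tendsto hX hx z) f)
  have h2 := tendsto_circle_smul (h := fun v => comp v (pullback (hoffman m) hL f))
    (C := ‖pullback (hoffman m) hL f‖) (fun w => norm_comp_le _ _) (tendsto_budde m y)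
    (z := z) (c := hoffman y (budde m y • z) (pullback (hoffman m) hL f)) (by
      simp only [comp_val]
      exact tendsto_val_hoffman y _ _)
  refine h2.congr fun v => ?_
  rw [comp_val, ← hoffman_mobius hm]
  exact pullback_apply (hoffman m) hL f _

/-! ### Points outside the closure of the disc -/

theorem toward_eq_iInf (y : MaxIdeal) :
    toward y = ⨅ f : Hinf, comap (fun w => f.1 w) (𝓝 (y f)) := by
  refine le_antisymm (le_iInf fun f => tendsto_iff_comap.1 (tendsto_val_toward y f)) ?_
  refine tendsto_iff_comap.1 (tendsto_point_iff.2 fun f => tendsto_iff_comap.2 ?_)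
  exact iInf_le _ f

/-- A character outside the closure of the disc kills finitely many functions without common
approximate zeros. -/
theorem exists_of_not_neBot {y : MaxIdeal} (hy : ¬(toward y).NeBot) :
    ∃ (s : Finset Hinf) (g : Hinf → Hinf), (∀ i ∈ s, y (g i) = 0) ∧
      ∀ w : 𝔻, ∃ i ∈ s, 1 ≤ ‖(g i).1 w‖ := by
  have h1 : (∅ : Set 𝔻) ∈ ⨅ f : Hinf, comap (fun w => f.1 w) (𝓝 (y f)) := by
    rw [← toward_eq_iInf, not_neBot.1 hy]
    exact mem_bot
  obtain ⟨I, hI, V, hV, hVe⟩ := mem_iInf.1 h1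
  have h2 : ∀ i : I, ∃ ε > 0, ∀ w : 𝔻, ‖i.1.1 w - y i.1‖ < ε → w ∈ V i := fun i => by
    obtain ⟨O, hO, hOV⟩ := mem_comap.1 (hV i)
    obtain ⟨ε, hε, hεO⟩ := Metric.mem_nhds_iff.1 hO
    exact ⟨ε, hε, fun w hw => hOV (hεO (mem_ball_iff_norm.2 hw))⟩
  choose ε hε hεV using h2
  classical
  let g : Hinf → Hinf := fun f =>
    if h : f ∈ I then ((ε ⟨f, h⟩ : ℂ)⁻¹) • (f - algebraMap ℂ Hinf (y f)) else 0
  refine ⟨hI.toFinset, g, fun f hf => ?_, fun w => ?_⟩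
  · simp only [g, dif_pos (hI.mem_toFinset.1 hf)]
    rw [map_smul, map_sub, AlgHomClass.commutes]
    simp
  · by_contra! hcon
    have h3 : w ∈ (∅ : Set 𝔻) := by
      rw [hVe, Set.mem_iInter]
      refine fun i => hεV i w ?_
      have h4 := hcon i.1 (hI.mem_toFinset.2 i.2)
      simp only [g, dif_pos i.2] at h4
      rw [smul_val, norm_mul, sub_val, algebraMap_val, norm_inv, Complex.norm_real,
        Real.norm_of_nonneg (hε i).le, inv_mul_lt_one₀ (hε i)] at h4
      exact h4
    exact h3

/-- If the extension of `L_m` maps `y` to a limit of points of an interpolating set, then `y` lies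
in the closure of the disc. For otherwise there are `g_i` in the kernel of `y` without common
approximate zeros on the disc. Interpolation on the preimages of `Z` under `L_w` gives
functions `h_i` such that `∑ g_i h_i - 1` is a multiple of `B ∘ L_w`, where `B` is the Blaschke
product of `Z`. In the limit `w → m`, the character `y` kills both `∑ g_i h_i` and `B ∘ L_m`. -/
theorem neBot_of_extend_hoffman {m y : MaxIdeal} (hm : (toward m).NeBot)
    (hL : IsAnalyticMap (hoffman m)) {δ : ℝ} (hδ : 0 < δ) {Z : Set 𝔻} (hZ : IsInterpolating δ Z)
    {V : Filter 𝔻} [V.NeBot] (hV : V ≤ toward (extend (hoffman m) hL y)) (hVZ : Z ∈ V) :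
    (toward y).NeBot := by
  by_contra hy
  obtain ⟨s, g, hgy, hg⟩ := exists_of_not_neBot hy
  obtain ⟨B, hB⟩ := exists_isBlaschke Z
  let σ : 𝔻 → ℝ := fun u => ∑ i ∈ s, ‖(g i).1 u‖ ^ 2
  have hσ : ∀ u, 1 ≤ σ u := fun u => by
    obtain ⟨i, hi, h1⟩ := hg u
    exact (one_le_pow₀ h1).trans (Finset.single_le_sum
      (f := fun i => ‖(g i).1 u‖ ^ 2) (fun i _ => sq_nonneg _) hi)
  let c : Hinf → 𝔻 → ℂ := fun i u => conj ((g i).1 u) / σ u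
  have hc : ∀ i u, ‖c i u‖ ≤ ‖g i‖ := fun i u => by
    rw [norm_div, Complex.norm_conj, Complex.norm_real,
      Real.norm_of_nonneg (zero_le_one.trans (hσ u))]
    exact (div_le_self (norm_nonneg _) (hσ u)).trans (norm_val_le _ _)
  have hsum : ∀ u, ∑ i ∈ s, (g i).1 u * c i u = 1 := fun u => by
    have h1 : ∀ i ∈ s, (g i).1 u * c i u = (‖(g i).1 u‖ ^ 2 : ℝ) / (σ u : ℂ) := fun i _ => by
      rw [← mul_div_assoc, Complex.mul_conj']
      push_cast
      rfl
    rw [Finset.sum_congr rfl h1, ← Finset.sum_div, ← Complex.ofReal_sum]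
    exact div_self (Complex.ofReal_ne_zero.2 (zero_lt_one.trans_le (hσ u)).ne')
  choose h hh hhZ using fun (i : Hinf) (w : 𝔻) =>
    hZ.exists_interp hδ (fun a => c i (mobius (-w) a)) (norm_nonneg (g i)) fun a _ => hc i _
  set C : ℝ := ∑ i ∈ s, ‖g i‖ * (interpConst δ * ‖g i‖) + 1 with hC
  have hC0 : 0 ≤ C := by
    have := interpConst_pos hδ
    positivity
  choose k hk hkB using fun w : 𝔻 => hB.exists_eq_mul (∑ i ∈ s, comp (-w) (g i) * h i w - 1)
    fun a ha => by
      rw [sub_val, sum_val, one_val, sub_eq_zero, ← hsum (mobius (-w) a)]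
      refine Finset.sum_congr rfl fun i _ => ?_
      rw [mul_val, comp_val, hhZ i w a ha]
  have hkC : ∀ w, ‖k w‖ ≤ C := fun w => (hk w).trans <| norm_le_of_forall hC0 fun u => by
    rw [sub_val, one_val, sum_val]
    refine (norm_sub_le _ _).trans ?_
    rw [norm_one, hC]
    refine add_le_add ((norm_sum_le _ _).trans (Finset.sum_le_sum fun i _ => ?_)) le_rfl
    rw [mul_val, norm_mul]
    exact mul_le_mul ((norm_val_le _ _).trans (norm_comp_le _ _))
      ((norm_val_le _ _).trans (hh i w)) (norm_nonneg _) (norm_nonneg _)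
  have hid : ∀ w u : 𝔻, ∑ i ∈ s, (g i).1 u * (comp w (h i w)).1 u - 1 =
      B.1 (mobius w u) * (comp w (k w)).1 u := fun w u => by
    have h1 := congrArg (fun F : Hinf => F.1 (mobius w u)) (hkB w)
    simp only [sub_val, sum_val, one_val, mul_val, comp_val, mobius_neg_mobius] at h1
    simp only [comp_val]
    exact h1
  let U := Ultrafilter.of (toward m)
  have hU : ↑U ≤ toward m := Ultrafilter.of_le _
  choose H _ hH using fun i : Hinf => exists_tendsto_of_norm_le U
    (f := fun w => comp w (h i w)) fun w => (norm_comp_le _ _).trans (hh i w)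
  obtain ⟨K, -, hK⟩ := exists_tendsto_of_norm_le U
    (f := fun w => comp w (k w)) fun w => (norm_comp_le _ _).trans (hkC w)
  have hfin : ∑ i ∈ s, g i * H i - 1 = pullback (hoffman m) hL B * K := hinf_ext fun u => by
    have h1 : Tendsto (fun w => ∑ i ∈ s, (g i).1 u * (comp w (h i w)).1 u - 1) U
        (𝓝 (∑ i ∈ s, (g i).1 u * (H i).1 u - 1)) :=
      (tendsto_finsetSum s fun i _ => (hH i u).const_mul _).sub_const 1
    have h2 := ((tendsto_val_hoffman m u B).mono_left hU).mul (hK u)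
    simp only [hid] at h1
    have h3 := tendsto_nhds_unique h1 h2
    rw [← pullback_apply (hoffman m) hL] at h3
    refine Eq.trans ?_ h3
    refine (sub_val _ _ u).trans ?_
    rw [sum_val]
    rfl
  have hyB : y (pullback (hoffman m) hL B) = 0 := hB.apply_eq_zero hV hVZ
  have h1 := congrArg y hfin
  rw [map_sub, map_mul, hyB, zero_mul, map_one, map_sum, Finset.sum_eq_zero fun i hi => by
    rw [map_mul, hgy i hi, zero_mul]] at h1
  simp at h1

/-- If `y` lies outside the closure of the disc, then `L_x` is constant for `x = L_m y`. -/
theorem hoffman_extend_of_not_neBot {m y : MaxIdeal} (hm : (toward m).NeBot)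
    (hy : ¬(toward y).NeBot) (hL : IsAnalyticMap (hoffman m)) (z : 𝔻) :
    hoffman (extend (hoffman m) hL y) z = extend (hoffman m) hL y := by
  by_cases hx : (toward (extend (hoffman m) hL y)).NeBot
  · by_contra hne
    obtain ⟨f, hf⟩ : ∃ f : Hinf, hoffman (extend (hoffman m) hL y) z f ≠
        extend (hoffman m) hL y f := by
      by_contra! hcon
      exact hne (maxIdeal_ext hcon)
    have hU := Ultrafilter.of_le (toward (extend (hoffman m) hL y))
    obtain ⟨δ, hδ, Z, V, hZ, hZV, hV⟩ := exists_isInterpolating hU (f := f) (z := z) fun hlim =>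
      hf (tendsto_nhds_unique ((tendsto_val_hoffman _ z f).mono_left hU) hlim)
    exact hy (neBot_of_extend_hoffman hm hL hδ hZ hV hZV)
  · exact hoffman_of_not_neBot hx z

theorem extend_hoffman_of_not_neBot {m : MaxIdeal} (hm : ¬(toward m).NeBot)
    (hL : IsAnalyticMap (hoffman m)) (φ : MaxIdeal) : extend (hoffman m) hL φ = m := by
  refine maxIdeal_ext fun f => ?_
  have h1 : pullback (hoffman m) hL f = algebraMap ℂ Hinf (m f) := hinf_ext fun z => by
    rw [pullback_apply, hoffman_of_not_neBot hm]
    exact (algebraMap_val _ z).symm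
  rw [extend_apply, h1, AlgHomClass.commutes]
  rfl

end Hoffman

/-- The limits that define `L_m` and `λ` exist, every `L_m` is analytic (so that it extends to the
maximal ideal space), and `L_m (L_y (λ(m, y) z)) = L_{L_m y} z`, where the outer `L_m` on the left
and the `L_m` in the index on the right are the extension. -/
theorem proposition1p1 :
    (∀ (m : MaxIdeal) (z : 𝔻),
      Tendsto (fun w : 𝔻 => point (mobius w z)) (toward m) (𝓝 (hoffman m z))) ∧
    (∀ x y : MaxIdeal,
      Tendsto (unimodularQuotient (proj x)) (toward y) (𝓝 (budde x y))) ∧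
    ∃ hL : ∀ m : MaxIdeal, IsAnalyticMap (hoffman m),
      ∀ (m y : MaxIdeal) (z : 𝔻),
        extend (hoffman m) (hL m) (hoffman y (budde m y • z)) =
          hoffman (extend (hoffman m) (hL m) y) z := by

  refine ⟨tendsto_hoffman, tendsto_budde, isAnalyticMap_hoffman, fun m y z => ?_⟩
  by_cases hm : (toward m).NeBot
  · by_cases hy : (toward y).NeBot
    · exact extend_hoffman_hoffman hm hy _ z
    · rw [hoffman_of_not_neBot hy, hoffman_extend_of_not_neBot hm hy]
  · rw [extend_hoffman_of_not_neBot hm, extend_hoffman_of_not_neBot hm, hoffman_of_not_neBot hm]
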